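/- **Setting.** Let $X_1,X_2,\dots$ be random variables on a probability space $(\Omega,\mathcal F,P)$ with values in a measurable space, $\mathbf X_n=(X_1,\dots,X_n)$. Let $\boldsymbol\Theta=\prod_{j}\Theta_j$ be a product of measurable spaces (finitely or infinitely many factors, at least $m$ of them, $m<\infty$), with product $\sigma$-algebra $\mathcal T$ and a prior probability measure $\pi$. For each $\theta\in\boldsymbol\Theta$ let $P_\theta$ be a probability law for the process; for every $n$ the true law of $\mathbf X_n$ and the laws $P_{\mathbf X_n|\theta}$ have densities $p$ and $f_\theta$ with respect to a common reference measure. (The model may be misspecified.) For $i=1,\dots,m$ one tests $H_{0i}:\theta_i\in\Theta_{0i}$ against $H_{1i}:\theta_i\in\Theta_{1i}$, where $\Theta_i=\Theta_{0i}\sqcup\Theta_{1i}$ (measurable). Put $R_n(\theta)=f_\theta(\mathbf X_n)/p(\mathbf X_n)$, $h(\theta)=\lim_n\frac1nE\log\frac{p(\mathbf X_n)}{f_\theta(\mathbf X_n)}\in[0,\infty]$, $h(A)=\operatorname{ess\,inf}_{A}h$ with respect to $\pi$ ($=\infty$ if $\pi(A)=0$), $J(\theta)=h(\theta)-h(\boldsymbol\Theta)$,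 $J(A)=\operatorname{ess\,inf}_AJ$, and $I=\{h=\infty\}$. For measurable $A$ and $\delta>0$ let $\tau(A,\delta)$ be the least (random) $t$ such that $\frac1n\log\int_AR_n\,d\pi\le\delta+\limsup_k\frac1k\log\int_AR_k\,d\pi$ for all $n>t$ ($\infty$ if there is none). **Assumptions.** * (S1) $R_n(\theta)$ is $\sigma(\mathbf X_n)\times\mathcal T$-measurable for every $n$. * (S2) For each $\theta$, almost surely $\frac1n\log R_n(\theta)\to-h(\theta)$. * (S3) The limit $h(\theta)$ exists in $[0,\infty]$ for every $\theta$ and $h$ is measurable. * (S4) $\pi(I)<1$. * (S5)–(S7) There are measurable sets $\mathcal G_n$ such that every $\theta$ lies in $\mathcal G_n$ for all large $n$, and: (5.1) $\pi(\mathcal G_n)\ge1-ae^{-\varsigma n}$ for some $a>0$, $\varsigma>2h(\boldsymbol\Theta)$; (5.2) for each $k$, almost surely, $\frac1n\log R_n(\theta)\to-h(\theta)$ as $n\to\infty$, uniformly over $\theta\in\mathcal G_k\setminus I$; and for each $k$, almost surely, for every real $K$ and all large $n$, $\frac1n\log R_n(\theta)\le K$ for $\pi$-almost every $\theta\in\mathcal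 G_k\cap I$; (5.3) $h(\mathcal G_n)\to h(\boldsymbol\Theta)$; (6) for each measurable $A$ with $h(A)<\infty$ and each $\delta>0$, almost surely $n>\tau(\mathcal G_n\cap A,\delta)$ for all large $n$; (7) $h(\mathcal G_n\cap A)\to h(A)$ for every measurable $A$ with $\pi(A)>0$. For $d\in\{0,1\}^m$ let $\boldsymbol\Theta(d)=\{\theta:\theta_i\in\Theta_{d_ii},\ i\le m\}$. Assume that exactly one configuration $d^t$ (the true decision configuration) satisfies $J(\boldsymbol\Theta(d^t))=J(\boldsymbol\Theta)$. Call $H_{0i}$ true if $d^t_i=0$, and let $m_0$ be the number of true null hypotheses. **Procedure.** Let $v_{in}$ be the posterior probability of $H_{1i}$ given $\mathbf X_n$. For $\beta\in(0,1)$ the additive loss procedure, with loss $c\sum_id_i(1-r_i)+\sum_i(1-d_i)r_i$, where $r_i=\mathbf 1\{H_{1i}\text{ is true}\}$ and $\beta=c/(1+c)$, takes the decisions $d_i=\mathbf 1\{v_{in}>\beta\}$, which minimize the posterior expected loss. Its positive Bayesian false discovery rate is $$pBFDR_\beta=E_{\mathbf X_n}\Big[\frac{\sum_id_i(1-v_{in})}{(\sum_id_i)\vee1}\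 \Big|\ \sum_id_i>0\Big],$$ the expectation being with respect to the true law $P$ of $\mathbf X_n$. **Theorem.** Assume moreover that for each $i$ with $d^t_i=0$ one has $h(\{\theta_i\in\Theta_{1i}\})<\infty$ and the law of $v_{in}$ has asymptotically no atoms: $\sup_{x\in\mathbb R}P(v_{in}=x)\to0$ as $n\to\infty$ (for example, $v_{in}$ has a continuous distribution for all large $n$). Let $m_0<m$. Then for every $0<\alpha<\frac{m_0}{m}$ there is a sequence $\beta_n\in(0,1)$ with $\beta_n\to0$ such that, for all large $n$, the event $\sum_id_i>0$ in the definition of $pBFDR_{\beta_n}$ has positive probability, and $$\lim_{n\to\infty}pBFDR_{\beta_n}=\alpha .$$ -/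

import Mathlib

open MeasureTheory ProbabilityTheory Filter Topology
open scoped ENNReal

noncomputable section

/-- A Bayesian multiple testing problem with `m` tested parameters `θ (inl i)` and arbitrarily many
further parameters `θ (inr k)`, under a possibly misspecified model. The `i`-th hypotheses are
`H₀ᵢ : θᵢ ∉ alt i` versus `H₁ᵢ : θᵢ ∈ alt i`. -/
structure TestingProblem (Ω Ξ κ : Type*) [MeasurableSpace Ω] [MeasurableSpace Ξ] (m : ℕ)
    (Θ : Fin m ⊕ κ → Type*) [∀ j, MeasurableSpace (Θ j)] where
  /-- the true probability measure -/
  P : Measure Ω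
  isProbabilityMeasure_P : IsProbabilityMeasure P
  /-- the observations; `X k` is the `(k + 1)`-st one -/
  X : ℕ → Ω → Ξ
  measurable_X : ∀ k, Measurable (X k)
  /-- the postulated law of the whole observation process, given the parameter -/
  model : (∀ j, Θ j) → Measure (ℕ → Ξ)
  isProbabilityMeasure_model : ∀ θ, IsProbabilityMeasure (model θ)
  /-- common reference measures for the laws of the first `n` observations -/
  ref : ∀ n : ℕ, Measure (Fin n → Ξ)
  /-- the true density of the first `n` observations -/
  p : ∀ n : ℕ, (Fin n → Ξ) → ℝ≥0∞
  /-- the postulated density of the first `n` observations -/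
  f : ∀ n : ℕ, (∀ j, Θ j) → (Fin n → Ξ) → ℝ≥0∞
  measurable_p : ∀ n, Measurable (p n)
  measurable_f : ∀ n θ, Measurable (f n θ)
  map_data : ∀ n : ℕ,
    P.map (fun ω (k : Fin n) => X k ω) = (ref n).withDensity (p n)
  map_model : ∀ (n : ℕ) (θ : ∀ j, Θ j),
    (model θ).map (fun x (k : Fin n) => x k) = (ref n).withDensity (f n θ)
  prior : Measure (∀ j, Θ j)
  isProbabilityMeasure_prior : IsProbabilityMeasure prior
  /-- the alternative regions `Θ₁ᵢ`; the null regions are their complements -/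
  alt : ∀ i : Fin m, Set (Θ (Sum.inl i))
  measurableSet_alt : ∀ i, MeasurableSet (alt i)

namespace TestingProblem

variable {Ω Ξ κ : Type*} [MeasurableSpace Ω] [MeasurableSpace Ξ] {m : ℕ}
  {Θ : Fin m ⊕ κ → Type*} [∀ j, MeasurableSpace (Θ j)]

/-- The first `n` observations. -/
def data (T : TestingProblem Ω Ξ κ m Θ) (n : ℕ) (ω : Ω) : Fin n → Ξ := fun k => T.X k ω

/-- The likelihood ratio `Rₙ(θ) = f_θ(Xₙ) / p(Xₙ)`. -/
def R (T : TestingProblem Ω Ξ κ m Θ) (n : ℕ) (θ : ∀ j, Θ j) (ω : Ω) : ℝ≥0∞ :=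
  T.f n θ (T.data n ω) / T.p n (T.data n ω)

/-- The Kullback-Leibler divergence of the postulated law of the first `n` observations from the
true one, divided by `n`. -/
def klPerObs (T : TestingProblem Ω Ξ κ m Θ) (n : ℕ) (θ : ∀ j, Θ j) : ℝ≥0∞ :=
  InformationTheory.klDiv (T.P.map (T.data n))
    ((T.model θ).map (fun x (k : Fin n) => x k)) / n

/-- The Kullback-Leibler divergence rate `h(θ)` (a limit whenever the limit exists). -/
def h (T : TestingProblem Ω Ξ κ m Θ) (θ : ∀ j, Θ j) : ℝ≥0∞ :=
  limsup (fun n : ℕ => T.klPerObs n θ) atTop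

/-- `h(A)`, the essential infimum of `h` over `A` with respect to the prior (`∞` if `A` is null). -/
def hSet (T : TestingProblem Ω Ξ κ m Θ) (A : Set (∀ j, Θ j)) : ℝ≥0∞ :=
  essInf T.h (T.prior.restrict A)

/-- `J(A)`, the essential infimum over `A` of `J(θ) = h(θ) - h(Θ)`. -/
def JSet (T : TestingProblem Ω Ξ κ m Θ) (A : Set (∀ j, Θ j)) : ℝ≥0∞ :=
  essInf (fun θ => T.h θ - T.hSet Set.univ) (T.prior.restrict A)

/-- The set of parameters with infinite divergence rate. -/
def I (T : TestingProblem Ω Ξ κ m Θ) : Set (∀ j, Θ j) := {θ | T.h θ = ⊤}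

/-- `n⁻¹ log ∫_A Rₙ(θ) π(dθ)`. -/
def logEvidence (T : TestingProblem Ω Ξ κ m Θ) (A : Set (∀ j, Θ j)) (n : ℕ) (ω : Ω) : EReal :=
  ENNReal.log (∫⁻ θ in A, T.R n θ ω ∂T.prior) / (n : EReal)

/-- The random time `τ(A, δ)`: the least `t` such that
`n⁻¹ log ∫_A Rₙ dπ ≤ δ + limsupₖ k⁻¹ log ∫_A Rₖ dπ` for all `n > t` (`∞` if there is none). -/
def tau (T : TestingProblem Ω Ξ κ m Θ) (A : Set (∀ j, Θ j)) (δ : ℝ) (ω : Ω) : ℕ∞ :=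
  sInf {t : ℕ∞ | ∀ n : ℕ, t < (n : ℕ∞) →
    T.logEvidence A n ω ≤ (δ : EReal) + limsup (fun k : ℕ => T.logEvidence A k ω) atTop}

/-- The regularity conditions on the model, the prior and the true process. -/
structure Regular (T : TestingProblem Ω Ξ κ m Θ) : Prop where
  /-- the likelihood ratio is jointly measurable in the first `n` observations and `θ` -/
  measurable_R : ∀ n : ℕ,
    Measurable[(MeasurableSpace.comap (T.data n) inferInstance).prod inferInstance]
      (fun q : Ω × (∀ j, Θ j) => T.R n q.2 q.1)
  /-- asymptotic equipartition property -/
  equipartition : ∀ θ, ∀ᵐ ω ∂T.P,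
    Tendsto (fun n : ℕ => ENNReal.log (T.R n θ ω) / (n : EReal)) atTop (𝓝 (-(T.h θ : EReal)))
  /-- the divergence rate exists as a limit -/
  tendsto_h : ∀ θ, Tendsto (fun n : ℕ => T.klPerObs n θ) atTop (𝓝 (T.h θ))
  measurable_h : Measurable T.h
  prior_I_lt_one : T.prior T.I < 1
  /-- existence of sieves -/
  sieve : ∃ (G : ℕ → Set (∀ j, Θ j)) (a ς : ℝ),
    (∀ n, MeasurableSet (G n)) ∧
    -- the sieves converge to the whole parameter space
    (∀ θ, ∀ᶠ n in atTop, θ ∈ G n) ∧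
    -- exponentially small prior mass outside the sieves
    0 < a ∧ 2 * T.hSet Set.univ < ENNReal.ofReal ς ∧
    (∀ n : ℕ, 1 - a * Real.exp (-(ς * n)) ≤ T.prior.real (G n)) ∧
    -- uniform equipartition on each sieve, outside `I` and (as divergence to `-∞`) inside `I`
    (∀ k, ∀ᵐ ω ∂T.P, ∀ ε : ℝ, 0 < ε → ∀ᶠ n : ℕ in atTop, ∀ θ ∈ G k \ T.I,
      -(T.h θ : EReal) - (ε : EReal) ≤ ENNReal.log (T.R n θ ω) / (n : EReal) ∧
      ENNReal.log (T.R n θ ω) / (n : EReal) ≤ -(T.h θ : EReal) + (ε : EReal)) ∧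
    (∀ k, ∀ᵐ ω ∂T.P, ∀ K : ℝ, ∀ᶠ n : ℕ in atTop, ∀ᵐ θ ∂T.prior, θ ∈ G k ∩ T.I →
      ENNReal.log (T.R n θ ω) / (n : EReal) ≤ (K : EReal)) ∧
    Tendsto (fun n => T.hSet (G n)) atTop (𝓝 (T.hSet Set.univ)) ∧
    -- the convergence on the sieves is fast enough
    (∀ A, MeasurableSet A → T.hSet A < ⊤ → ∀ δ : ℝ, 0 < δ →
      ∀ᵐ ω ∂T.P, ∀ᶠ n : ℕ in atTop, T.tau (G n ∩ A) δ ω < (n : ℕ∞)) ∧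
    (∀ A, MeasurableSet A → 0 < T.prior A →
      Tendsto (fun n => T.hSet (G n ∩ A)) atTop (𝓝 (T.hSet A)))

/-- The event `H₁ᵢ` in the full parameter space. -/
def altSet (T : TestingProblem Ω Ξ κ m Θ) (i : Fin m) : Set (∀ j, Θ j) :=
  {θ | θ (Sum.inl i) ∈ T.alt i}

/-- The cell `Θ(d)` of parameters for which every decision in `d` is correct; `d i = true` means that
the `i`-th null hypothesis is rejected. -/
def cell (T : TestingProblem Ω Ξ κ m Θ) (d : Fin m → Bool) : Set (∀ j, Θ j) :=
  {θ | ∀ i, d i = true ↔ θ ∈ T.altSet i}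

/-- `d` is the true decision configuration: it is the only one whose cell attains the minimal
divergence rate. -/
def IsTrueDecision (T : TestingProblem Ω Ξ κ m Θ) (d : Fin m → Bool) : Prop :=
  ∀ d' : Fin m → Bool, T.JSet (T.cell d') = T.JSet Set.univ ↔ d' = d

/-- The posterior distribution given the first `n` observations (Bayes' formula). -/
def posterior (T : TestingProblem Ω Ξ κ m Θ) (n : ℕ) (ω : Ω) : Measure (∀ j, Θ j) :=
  (∫⁻ θ, T.f n θ (T.data n ω) ∂T.prior)⁻¹ •
    T.prior.withDensity (fun θ => T.f n θ (T.data n ω))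

/-- The posterior probability `vᵢₙ` of `H₁ᵢ`. -/
def v (T : TestingProblem Ω Ξ κ m Θ) (n : ℕ) (i : Fin m) (ω : Ω) : ℝ :=
  (T.posterior n ω).real (T.altSet i)

/-- The additive loss `c ∑ dᵢ (1 - rᵢ) + ∑ (1 - dᵢ) rᵢ`, where `rᵢ` indicates `H₁ᵢ`. -/
def additiveLoss (T : TestingProblem Ω Ξ κ m Θ) (c : ℝ) (d : Fin m → Bool) (θ : ∀ j, Θ j) : ℝ :=
  c * ∑ i, (if d i then 1 else 0) * (1 - (T.altSet i).indicator (fun _ => (1 : ℝ)) θ) +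
    ∑ i, (1 - (if d i then 1 else 0)) * (T.altSet i).indicator (fun _ => (1 : ℝ)) θ

/-- The decision rule of the additive loss with penalizing constant `β = c / (1 + c)`, applied to the
posterior `ρ`: reject the `i`-th null hypothesis if and only if `ρ(H₁ᵢ) > β`. -/
def additiveRule (T : TestingProblem Ω Ξ κ m Θ) (β : ℝ) (ρ : Measure (∀ j, Θ j)) : Fin m → Bool :=
  fun i => decide (β < ρ.real (T.altSet i))

theorem measurableSet_altSet (T : TestingProblem Ω Ξ κ m Θ) (i : Fin m) :
    MeasurableSet (T.altSet i) :=
  (measurable_pi_apply (Sum.inl i)) (T.measurableSet_alt i)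

theorem integral_additiveLoss (T : TestingProblem Ω Ξ κ m Θ) (c : ℝ) (d : Fin m → Bool)
    (ρ : Measure (∀ j, Θ j)) [IsProbabilityMeasure ρ] :
    ∫ θ, T.additiveLoss c d θ ∂ρ =
      ∑ i, (if d i then c * (1 - ρ.real (T.altSet i)) else ρ.real (T.altSet i)) := by
  have hi : ∀ i, Integrable ((T.altSet i).indicator (fun _ => (1 : ℝ))) ρ := fun i =>
    (integrable_const (1 : ℝ)).indicator (T.measurableSet_altSet i)
  have hv : ∀ i, ∫ θ, (T.altSet i).indicator (fun _ => (1 : ℝ)) θ ∂ρ = ρ.real (T.altSet i) := by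
    intro i
    rw [integral_indicator (T.measurableSet_altSet i)]
    simp
  have h1 : ∀ i, Integrable (fun θ => (if d i then (1 : ℝ) else 0) *
      (1 - (T.altSet i).indicator (fun _ => (1 : ℝ)) θ)) ρ := fun i =>
    (((integrable_const (1 : ℝ)).sub (hi i)).const_mul _)
  have h2 : ∀ i, Integrable (fun θ => (1 - (if d i then (1 : ℝ) else 0)) *
      (T.altSet i).indicator (fun _ => (1 : ℝ)) θ) ρ := fun i => (hi i).const_mul _
  unfold additiveLoss
  rw [integral_add ((integrable_finsetSum _ fun i _ => h1 i).const_mul c)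
    (integrable_finsetSum _ fun i _ => h2 i), integral_const_mul,
    integral_finsetSum _ fun i _ => h1 i, integral_finsetSum _ fun i _ => h2 i,
    Finset.mul_sum, ← Finset.sum_add_distrib]
  refine Finset.sum_congr rfl fun i _ => ?_
  rw [integral_const_mul, integral_const_mul, integral_sub (integrable_const _) (hi i), hv i]
  split_ifs <;> simp

/-- The rule above minimizes the posterior expected additive loss. -/
theorem additiveRule_minimizes (T : TestingProblem Ω Ξ κ m Θ) (c : ℝ) (hc : 0 < c)
    (ρ : Measure (∀ j, Θ j)) [IsProbabilityMeasure ρ] (d : Fin m → Bool) :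
    ∫ θ, T.additiveLoss c (T.additiveRule (c / (1 + c)) ρ) θ ∂ρ ≤
      ∫ θ, T.additiveLoss c d θ ∂ρ := by
  rw [integral_additiveLoss, integral_additiveLoss]
  refine Finset.sum_le_sum fun i _ => ?_
  have hc1 : 0 < 1 + c := by linarith
  by_cases hlt : c / (1 + c) < ρ.real (T.altSet i)
  · have h2 := (div_lt_iff₀ hc1).1 hlt
    simp only [additiveRule, hlt, decide_true, if_true]
    split_ifs <;> nlinarith
  · have h2 := (le_div_iff₀ hc1).1 (not_lt.1 hlt)
    simp only [additiveRule, hlt, decide_false]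
    split_ifs <;> simp_all
    nlinarith

/-- The decisions of the additive loss procedure, given the first `n` observations. -/
def decision (T : TestingProblem Ω Ξ κ m Θ) (n : ℕ) (β : ℝ) (ω : Ω) : Fin m → Bool :=
  T.additiveRule β (T.posterior n ω)

/-- The posterior false discovery rate `∑ dᵢ (1 - vᵢₙ) / (∑ dᵢ ∨ 1)` of the decision taken. -/
def posteriorFDR (T : TestingProblem Ω Ξ κ m Θ) (n : ℕ) (β : ℝ) (ω : Ω) : ℝ :=
  (∑ i, if T.decision n β ω i then 1 - T.v n i ω else 0) /
    max (∑ i, if T.decision n β ω i then (1 : ℝ) else 0) 1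

/-- The event that at least one null hypothesis is rejected. -/
def someRejection (T : TestingProblem Ω Ξ κ m Θ) (n : ℕ) (β : ℝ) : Set Ω :=
  {ω | T.decision n β ω ≠ fun _ => false}

/-- The positive Bayesian false discovery rate: the conditional expectation of the posterior false
discovery rate over the data, given that at least one null hypothesis is rejected. -/
def pBFDR (T : TestingProblem Ω Ξ κ m Θ) (n : ℕ) (β : ℝ) : ℝ :=
  ∫ ω, T.posteriorFDR n β ω ∂(ProbabilityTheory.cond T.P (T.someRejection n β))

/-- The number of true null hypotheses under the true decision configuration `d`. -/
def numTrueNulls (d : Fin m → Bool) : ℕ := (Finset.univ.filter fun i => d i = false).card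

end TestingProblem

end

/-!
The theorem combines posterior consistency with an intermediate value argument in the threshold `β`.

*Consistency.* Let `A` be the complement of the cell of the true decision. Only finitely many cells
make up `A` and none of them attains the minimal divergence rate `h(Θ)`, so `h ≥ b > h(Θ)` almost
everywhere on `A` (`Regular.exists_forall_ae_le_h`). Since `0 < α < m₀ / m` there is a true null, and
`A` contains its alternative; hence `h(A) < ∞` and the rate condition on `τ` applies to `A`. For a
suitable `c` strictly between `h(Θ)` and `b`, almost surely `e^{cn} ∫_A Rₙ dπ → 0`
(`Regular.exists_ae_tendsto_exp_mul_setLIntegral_R`): outside the sieves the expected evidence is at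
most their exponentially small prior mass, and inside them it is controlled by uniform equipartition
and by `τ`. On the other hand `e^{cn} ∫ Rₙ dπ → ∞` by Fatou's lemma
(`Regular.ae_tendsto_exp_mul_lintegral_R`). The posterior mass of `A` is the quotient, so it tends to
`0`, and `vᵢₙ` tends almost surely to `1` or `0` according to the true decision
(`Regular.ae_tendsto_v`).

*Choice of the threshold.* The rate `pBFDR` is the expected posterior false discovery rate divided by
the probability of a rejection, and both depend only on the law of the vector of the `vᵢₙ`. By
consistency, at every fixed threshold the expectation tends to `0`. The absence of atoms gives
`P(vᵢₙ = 0) → 0` for true nulls, so for a sufficiently tiny threshold (depending on `n`) everything is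
rejected with high probability and the expectation is close to `m₀ / m > α`. Moving the threshold from
`β` to `β'` changes the expectation by at most the probability that some `vᵢₙ` lies in `(β, β']`;
therefore the value `α` is attained up to the mass of the atoms at one point
(`exists_abs_integral_thresholdFDR_sub_le`), which vanishes asymptotically. Some hypothesis is false,
so a rejection has probability tending to one and the denominator is harmless
(`eventually_exists_threshold`). A diagonal choice over the tolerances yields the sequence `βₙ`
(`exists_seq_tendsto_zero_of_eventually_exists`).
-/

/-! ### Approximate intermediate values and diagonal sequences -/

/-- A function whose increments are dominated by a finite measure `Q` satisfies the intermediate value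
theorem up to the mass of an atom of `Q`. -/
theorem exists_abs_sub_le_measureReal_singleton (Q : Measure ℝ) [IsFiniteMeasure Q] {F : ℝ → ℝ}
    (hF : ∀ x y, x ≤ y → |F x - F y| ≤ Q.real (Set.Ioc x y)) {a b α : ℝ} (hab : a ≤ b)
    (ha : α ≤ F a) (hb : F b ≤ α) : ∃ s ∈ Set.Icc a b, |F s - α| ≤ Q.real {s} := by
  set S : Set ℝ := {x | x ∈ Set.Icc a b ∧ α ≤ F x}
  have haS : a ∈ S := ⟨⟨le_rfl, hab⟩, ha⟩
  have hbd : BddAbove S := ⟨b, fun x hx => hx.1.2⟩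
  set s := sSup S
  have has : a ≤ s := le_csSup hbd haS
  have hsb : s ≤ b := csSup_le ⟨a, haS⟩ fun x hx => hx.1.2
  have hu : ∀ n : ℕ, 0 < 1 / ((n : ℝ) + 1) := fun n => by positivity
  have hu0 := tendsto_one_div_add_atTop_nhds_zero_nat (𝕜 := ℝ)
  refine ⟨s, ⟨has, hsb⟩, abs_le.2 ⟨?_, ?_⟩⟩
  · -- points of `S` accumulate at the supremum from the left, and `Ioc (s - r) s` shrinks to `{s}`
    have hlim : Tendsto (fun n : ℕ => Q.real (Set.Ioc (s - 1 / ((n : ℝ) + 1)) s)) atTop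
        (𝓝 (Q.real {s})) := by
      have hI : (⋂ n : ℕ, Set.Ioc (s - 1 / ((n : ℝ) + 1)) s) = {s} := by
        ext x
        simp only [Set.mem_iInter, Set.mem_Ioc, Set.mem_singleton_iff]
        refine ⟨fun h => le_antisymm (h 0).2 ?_, fun h n => by
          subst h; exact ⟨by linarith [hu n], le_rfl⟩⟩
        have := hu0.const_sub s
        rw [sub_zero] at this
        exact le_of_tendsto this (Eventually.of_forall fun n => (h n).1.le)
      rw [← hI]
      refine (ENNReal.tendsto_toReal (measure_ne_top _ _)).comp
        (tendsto_measure_iInter_atTop (fun n => measurableSet_Ioc.nullMeasurableSet) ?_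
          ⟨0, measure_ne_top _ _⟩)
      exact fun i j hij => Set.Ioc_subset_Ioc_left
        (sub_le_sub_left (one_div_le_one_div_of_le (by positivity) (by gcongr)) _)
    have hle : ∀ n : ℕ, α - F s ≤ Q.real (Set.Ioc (s - 1 / ((n : ℝ) + 1)) s) := by
      intro n
      obtain ⟨x, hx, hxs⟩ := exists_lt_of_lt_csSup ⟨a, haS⟩ (sub_lt_self s (hu n))
      have h1 := (abs_le.1 (hF x s (le_csSup hbd hx))).2
      have h2 : Q.real (Set.Ioc x s) ≤ Q.real (Set.Ioc (s - 1 / ((n : ℝ) + 1)) s) :=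
        measureReal_mono (Set.Ioc_subset_Ioc_left hxs.le)
      linarith [hx.2]
    linarith [ge_of_tendsto' hlim hle]
  · rcases hsb.eq_or_lt with hsb | hsb
    · rw [hsb]
      linarith [measureReal_nonneg (μ := Q) (s := {b})]
    -- to the right of the supremum `F < α`, and `Ioc s (s + r)` shrinks to the empty set
    have hlim : Tendsto (fun n : ℕ => Q.real (Set.Ioc s (s + 1 / ((n : ℝ) + 1)))) atTop
        (𝓝 0) := by
      have hI : (⋂ n : ℕ, Set.Ioc s (s + 1 / ((n : ℝ) + 1))) = ∅ := by
        ext x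
        simp only [Set.mem_iInter, Set.mem_Ioc, Set.mem_empty_iff_false, iff_false]
        intro h
        have := hu0.const_add s
        rw [add_zero] at this
        exact absurd (ge_of_tendsto this (Eventually.of_forall fun n => (h n).2))
          (not_le.2 (h 0).1)
      rw [show (0 : ℝ) = Q.real (⋂ n : ℕ, Set.Ioc s (s + 1 / ((n : ℝ) + 1))) by rw [hI]; simp]
      refine (ENNReal.tendsto_toReal (measure_ne_top _ _)).comp
        (tendsto_measure_iInter_atTop (fun n => measurableSet_Ioc.nullMeasurableSet) ?_
          ⟨0, measure_ne_top _ _⟩)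
      exact fun i j hij => Set.Ioc_subset_Ioc_right
        (add_le_add_right (one_div_le_one_div_of_le (by positivity) (by gcongr)) _)
    have hle : ∀ᶠ n : ℕ in atTop, F s - α ≤ Q.real (Set.Ioc s (s + 1 / ((n : ℝ) + 1))) := by
      have := hu0.const_add s
      rw [add_zero] at this
      filter_upwards [this.eventually_lt_const hsb] with n hn
      have h1 := (abs_le.1 (hF s (s + 1 / ((n : ℝ) + 1)) (by linarith [hu n]))).2
      have h2 : F (s + 1 / ((n : ℝ) + 1)) < α := by
        by_contra! h
        have := le_csSup hbd (show s + 1 / ((n : ℝ) + 1) ∈ S from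
          ⟨⟨by linarith [hu n], hn.le⟩, h⟩)
        linarith [hu n]
      linarith
    linarith [ge_of_tendsto hlim hle, measureReal_nonneg (μ := Q) (s := {s})]

/-- Diagonal choice: approximate solutions `β < ε` of `F n β = α` for every tolerance `ε` and all large
`n` can be combined into one sequence. -/
theorem exists_seq_tendsto_zero_of_eventually_exists {F : ℕ → ℝ → ℝ} {α : ℝ}
    (H : ∀ ε : ℝ, 0 < ε → ∀ᶠ n in atTop, ∃ β, 0 < β ∧ β < 1 ∧ β < ε ∧ |F n β - α| < ε) :
    ∃ β : ℕ → ℝ, (∀ n, 0 < β n ∧ β n < 1) ∧ Tendsto β atTop (𝓝 0) ∧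
      Tendsto (fun n => F n (β n)) atTop (𝓝 α) := by
  -- `β n` nearly minimizes the tolerance that is achievable for `F n`
  set S : ℕ → Set ℝ := fun n => {e | ∃ β, 0 < β ∧ β < 1 ∧ β < e ∧ |F n β - α| < e}
  have hS0 : ∀ n, ∀ e ∈ S n, 0 ≤ e := fun n e ⟨β, h0, _, h, _⟩ => (h0.trans h).le
  have hSn : ∀ n, (S n).Nonempty := fun n =>
    ⟨|F n 2⁻¹ - α| + 1, 2⁻¹, by norm_num, by norm_num,
      by linarith [abs_nonneg (F n 2⁻¹ - α), (by norm_num : (2⁻¹ : ℝ) < 1)], by linarith⟩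
  have hbd : ∀ n, BddBelow (S n) := fun n => ⟨0, fun e he => hS0 n e he⟩
  have hex : ∀ n : ℕ, ∃ e ∈ S n, e < sInf (S n) + 1 / ((n : ℝ) + 1) := fun n =>
    exists_lt_of_csInf_lt (hSn n) (lt_add_of_pos_right _ (by positivity))
  choose e heS he using hex
  choose β h0 h1 h2 h3 using heS
  have hinf : Tendsto (fun n => sInf (S n)) atTop (𝓝 0) := by
    refine tendsto_order.2 ⟨fun a ha => Eventually.of_forall fun n =>
      ha.trans_le (le_csInf (hSn n) fun e he => hS0 n e he), fun a ha => ?_⟩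
    filter_upwards [H (a / 2) (half_pos ha)] with n hn
    exact (csInf_le (hbd n) hn).trans_lt (half_lt_self ha)
  have he0 : Tendsto e atTop (𝓝 0) := by
    refine squeeze_zero (fun n => ((h0 n).trans (h2 n)).le) (fun n => (he n).le) ?_
    simpa using hinf.add (tendsto_one_div_add_atTop_nhds_zero_nat (𝕜 := ℝ))
  refine ⟨β, fun n => ⟨h0 n, h1 n⟩,
    squeeze_zero (fun n => (h0 n).le) (fun n => (h2 n).le) he0, ?_⟩
  rw [tendsto_iff_dist_tendsto_zero]
  exact squeeze_zero (fun n => dist_nonneg) (fun n => (h3 n).le) he0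

/-! ### Exponential rates -/

theorem ennreal_log_div_le_iff {x : ℝ≥0∞} {n : ℕ} (hn : 0 < n) (c : ℝ) :
    ENNReal.log x / (n : EReal) ≤ (c : EReal) ↔ x ≤ ENNReal.ofReal (Real.exp (n * c)) := by
  have hn' : (0 : EReal) < (n : EReal) := by exact_mod_cast hn
  rw [EReal.div_le_iff_le_mul hn' (EReal.coe_ne_top (n : ℝ)), ← ENNReal.log_le_log_iff,
    ENNReal.log_ofReal_of_pos (Real.exp_pos _), Real.log_exp, EReal.coe_mul]
  rfl

/-- Almost everywhere version of the first Borel-Cantelli lemma: nonnegative functions with summable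
integrals tend to `0` almost everywhere. -/
theorem ae_tendsto_zero_of_tsum_lintegral_ne_top {α : Type*} [MeasurableSpace α] {μ : Measure α}
    {g : ℕ → α → ℝ≥0∞} (hg : ∀ n, AEMeasurable (g n) μ) (h : ∑' n, ∫⁻ x, g n x ∂μ ≠ ⊤) :
    ∀ᵐ x ∂μ, Tendsto (fun n => g n x) atTop (𝓝 0) := by
  rw [← lintegral_tsum hg] at h
  filter_upwards [ae_lt_top' (AEMeasurable.tsum hg) h] with x hx
  exact ENNReal.tendsto_atTop_zero_of_tsum_ne_top hx.ne

theorem tsum_ofReal_exp_neg_mul_ne_top {a r : ℝ} (hr : 0 < r) :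
    ∑' n : ℕ, ENNReal.ofReal (a * Real.exp (-(r * n))) ≠ ⊤ := by
  have hs : Summable fun n : ℕ => a * Real.exp (-(r * n)) := by
    refine Summable.mul_left a ?_
    simpa [mul_comm] using (Real.summable_exp_nat_mul_iff.2 (neg_lt_zero.2 hr))
  exact hs.tsum_ofReal_ne_top

namespace TestingProblem

variable {Ω Ξ κ : Type*} [MeasurableSpace Ω] [MeasurableSpace Ξ] {m : ℕ}
  {Θ : Fin m ⊕ κ → Type*} [∀ j, MeasurableSpace (Θ j)]

/-! ### Likelihood ratios and the posterior -/

theorem measurable_data (T : TestingProblem Ω Ξ κ m Θ) (n : ℕ) : Measurable (T.data n) :=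
  measurable_pi_lambda _ fun k => T.measurable_X k

theorem Regular.measurable_uncurry_R {T : TestingProblem Ω Ξ κ m Θ} (hT : T.Regular) (n : ℕ) :
    Measurable fun q : Ω × (∀ j, Θ j) => T.R n q.2 q.1 := by
  refine (hT.measurable_R n).mono ?_ le_rfl
  exact sup_le_sup (MeasurableSpace.comap_mono (T.measurable_data n).comap_le) le_rfl

theorem Regular.measurable_setLIntegral_R {T : TestingProblem Ω Ξ κ m Θ} (hT : T.Regular) (n : ℕ)
    (A : Set (∀ j, Θ j)) : Measurable fun ω => ∫⁻ θ in A, T.R n θ ω ∂T.prior := by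
  have := T.isProbabilityMeasure_prior
  exact (hT.measurable_uncurry_R n).lintegral_prod_right'

theorem Regular.measurable_R_right {T : TestingProblem Ω Ξ κ m Θ} (hT : T.Regular) (n : ℕ) (ω : Ω) :
    Measurable fun θ => T.R n θ ω :=
  (hT.measurable_uncurry_R n).comp measurable_prodMk_left

theorem ae_p_ne_zero_and_ne_top (T : TestingProblem Ω Ξ κ m Θ) (n : ℕ) :
    ∀ᵐ ω ∂T.P, T.p n (T.data n ω) ≠ 0 ∧ T.p n (T.data n ω) ≠ ⊤ := by
  have := T.isProbabilityMeasure_P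
  have hmap : T.P.map (T.data n) = (T.ref n).withDensity (T.p n) := T.map_data n
  refine ae_of_ae_map (T.measurable_data n).aemeasurable (p := fun x => T.p n x ≠ 0 ∧ T.p n x ≠ ⊤) ?_
  rw [hmap, ae_withDensity_iff (T.measurable_p n)]
  have hfin : ∫⁻ x, T.p n x ∂T.ref n ≠ ⊤ := by
    rw [← setLIntegral_univ, ← withDensity_apply _ MeasurableSet.univ, ← hmap]
    have := Measure.isProbabilityMeasure_map (μ := T.P) (T.measurable_data n).aemeasurable
    exact measure_ne_top _ _
  filter_upwards [ae_lt_top (T.measurable_p n) hfin] with x hx h0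
  exact ⟨h0, hx.ne⟩

theorem lintegral_R_le_one (T : TestingProblem Ω Ξ κ m Θ) (n : ℕ) (θ : ∀ j, Θ j) :
    ∫⁻ ω, T.R n θ ω ∂T.P ≤ 1 := by
  have hmap : T.P.map (T.data n) = (T.ref n).withDensity (T.p n) := T.map_data n
  have hmeas : Measurable fun x => T.f n θ x / T.p n x :=
    (T.measurable_f n θ).div (T.measurable_p n)
  calc ∫⁻ ω, T.R n θ ω ∂T.P = ∫⁻ x, T.f n θ x / T.p n x ∂(T.P.map (T.data n)) :=
        (lintegral_map hmeas (T.measurable_data n)).symm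
    _ = ∫⁻ x, T.p n x * (T.f n θ x / T.p n x) ∂T.ref n := by
        rw [hmap, lintegral_withDensity_eq_lintegral_mul _ (T.measurable_p n) hmeas]; rfl
    _ ≤ ∫⁻ x, T.f n θ x ∂T.ref n := lintegral_mono fun x => ENNReal.mul_div_le
    _ = ((T.model θ).map fun x (k : Fin n) => x k) Set.univ := by
        rw [T.map_model n θ, withDensity_apply _ MeasurableSet.univ, setLIntegral_univ]
    _ ≤ 1 := by
        have := T.isProbabilityMeasure_model θ
        have := Measure.isProbabilityMeasure_map (μ := T.model θ)
          (f := fun x (k : Fin n) => x k)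
          (measurable_pi_lambda _ fun k => measurable_pi_apply _).aemeasurable
        exact prob_le_one

/-- Fubini together with `lintegral_R_le_one`: the evidence of `A` has expectation at most `π(A)`. -/
theorem Regular.lintegral_setLIntegral_R_le {T : TestingProblem Ω Ξ κ m Θ} (hT : T.Regular) (n : ℕ)
    (A : Set (∀ j, Θ j)) : ∫⁻ ω, ∫⁻ θ in A, T.R n θ ω ∂T.prior ∂T.P ≤ T.prior A := by
  have := T.isProbabilityMeasure_prior
  have := T.isProbabilityMeasure_P
  rw [lintegral_lintegral_swap (hT.measurable_uncurry_R n).aemeasurable]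
  calc ∫⁻ θ in A, ∫⁻ ω, T.R n θ ω ∂T.P ∂T.prior ≤ ∫⁻ _ in A, 1 ∂T.prior :=
        lintegral_mono fun θ => T.lintegral_R_le_one n θ
    _ = T.prior A := by simp

/-- The factor `p(Xₙ)` cancels in Bayes' formula, so the posterior is a ratio of evidences. -/
theorem ae_posterior_eq_div (T : TestingProblem Ω Ξ κ m Θ) (n : ℕ) :
    ∀ᵐ ω ∂T.P, ∀ A, MeasurableSet A → T.posterior n ω A =
      (∫⁻ θ in A, T.R n θ ω ∂T.prior) / ∫⁻ θ, T.R n θ ω ∂T.prior := by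
  filter_upwards [T.ae_p_ne_zero_and_ne_top n] with ω ⟨h0, htop⟩ A hA
  have hf : ∀ θ, T.f n θ (T.data n ω) = T.p n (T.data n ω) * T.R n θ ω := fun θ =>
    (ENNReal.mul_div_cancel h0 htop).symm
  simp only [posterior, Measure.smul_apply, withDensity_apply _ hA, smul_eq_mul, hf]
  rw [lintegral_const_mul' _ _ htop, lintegral_const_mul' _ _ htop, mul_comm, ← div_eq_mul_inv,
    ENNReal.mul_div_mul_left _ _ h0 htop]

theorem Regular.ae_lintegral_R_ne_top {T : TestingProblem Ω Ξ κ m Θ} (hT : T.Regular) :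
    ∀ᵐ ω ∂T.P, ∀ n, ∫⁻ θ, T.R n θ ω ∂T.prior ≠ ⊤ := by
  have := T.isProbabilityMeasure_prior
  refine ae_all_iff.2 fun n => ?_
  have h := hT.lintegral_setLIntegral_R_le n Set.univ
  have hm := hT.measurable_setLIntegral_R n Set.univ
  simp only [Measure.restrict_univ] at h hm
  filter_upwards [ae_lt_top hm (h.trans_lt (measure_lt_top _ _)).ne] with ω hω using hω.ne

theorem Regular.hSet_univ_ne_top {T : TestingProblem Ω Ξ κ m Θ} (hT : T.Regular) :
    T.hSet Set.univ ≠ ⊤ := by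
  have := T.isProbabilityMeasure_prior
  intro h
  have h1 : ∀ᵐ θ ∂T.prior, T.h θ = ⊤ := by
    have := ae_essInf_le (f := T.h) (μ := T.prior.restrict Set.univ)
    rw [Measure.restrict_univ] at this
    filter_upwards [this] with θ hθ
    rw [hSet, Measure.restrict_univ] at h
    exact top_le_iff.1 (h ▸ hθ)
  have h2 : T.prior T.I = 1 := by
    rw [← measure_univ (μ := T.prior)]
    exact measure_congr (eventuallyEq_univ.2 h1)
  exact hT.prior_I_lt_one.ne h2

/-! ### Exponential growth of the evidence and posterior consistency -/

/-- If `c` exceeds the minimal divergence rate `h(Θ)`, then `e^{cn}` times the evidence tends to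
infinity. -/
theorem Regular.ae_tendsto_exp_mul_lintegral_R {T : TestingProblem Ω Ξ κ m Θ} (hT : T.Regular)
    {c : ℝ} (hc : T.hSet Set.univ < ENNReal.ofReal c) :
    ∀ᵐ ω ∂T.P, Tendsto
      (fun n : ℕ => ENNReal.ofReal (Real.exp (n * c)) * ∫⁻ θ, T.R n θ ω ∂T.prior) atTop (𝓝 ⊤) := by
  have := T.isProbabilityMeasure_prior
  have := T.isProbabilityMeasure_P
  set B : Set (∀ j, Θ j) := {θ | T.h θ < ENNReal.ofReal c}
  have hB : MeasurableSet B := hT.measurable_h measurableSet_Iio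
  have hB0 : T.prior B ≠ 0 := by
    intro h0
    refine hc.not_ge (le_essInf_of_ae_le _ ?_)
    rw [Measure.restrict_univ]
    filter_upwards [measure_eq_zero_iff_ae_notMem.1 h0] with θ hθ using not_lt.1 hθ
  set g : ℕ → Ω × (∀ j, Θ j) → ℝ≥0∞ := fun n q =>
    ENNReal.ofReal (Real.exp (n * c)) * T.R n q.2 q.1
  have hg : ∀ n, Measurable (g n) := fun n => (hT.measurable_uncurry_R n).const_mul _
  -- by equipartition, `e^{cn} Rₙ(θ)` blows up almost surely for each `θ` in `B`
  have hpt : ∀ θ ∈ B, ∀ᵐ ω ∂T.P, liminf (fun n => g n (ω, θ)) atTop = ⊤ := by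
    intro θ hθ
    have hθ' : T.h θ < ENNReal.ofReal c := hθ
    obtain ⟨r, hr⟩ : ∃ r : ℝ, 0 ≤ r ∧ T.h θ = ENNReal.ofReal r :=
      ⟨(T.h θ).toReal, ENNReal.toReal_nonneg, (ENNReal.ofReal_toReal (hθ'.trans_le le_top).ne).symm⟩
    have hrc : r < c := by
      rw [hr.2] at hθ'
      exact (ENNReal.ofReal_lt_ofReal_iff_of_nonneg hr.1).1 hθ'
    filter_upwards [hT.equipartition θ] with ω hω
    have hrE : (T.h θ : EReal) = ((r : ℝ) : EReal) := by
      rw [hr.2, EReal.coe_ennreal_ofReal, max_eq_left hr.1]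
    have hlt : ((-((r + c) / 2) : ℝ) : EReal) < -(T.h θ : EReal) := by
      rw [hrE, ← EReal.coe_neg, EReal.coe_lt_coe_iff]
      linarith
    have hev : ∀ᶠ n : ℕ in atTop,
        ENNReal.ofReal (Real.exp (n * ((c - r) / 2))) ≤ g n (ω, θ) := by
      filter_upwards [hω.eventually_const_lt hlt, eventually_gt_atTop 0] with n hn hn0
      have hn' := mt (ennreal_log_div_le_iff (x := T.R n θ ω) hn0 (-((r + c) / 2))).2 hn.not_ge
      calc ENNReal.ofReal (Real.exp (n * ((c - r) / 2)))
          = ENNReal.ofReal (Real.exp (n * c)) *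
              ENNReal.ofReal (Real.exp (n * (-((r + c) / 2)))) := by
            rw [← ENNReal.ofReal_mul (Real.exp_nonneg _), ← Real.exp_add]; congr 2; ring
        _ ≤ g n (ω, θ) := mul_le_mul_right (not_le.1 hn').le _
    have htop : Tendsto (fun n : ℕ => ENNReal.ofReal (Real.exp (n * ((c - r) / 2)))) atTop
        (𝓝 ⊤) :=
      ENNReal.tendsto_ofReal_atTop.comp (Real.tendsto_exp_atTop.comp
        (tendsto_natCast_atTop_atTop.atTop_mul_const (by linarith)))
    exact (tendsto_nhds_top_mono htop hev).liminf_eq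
  have hae : ∀ᵐ ω ∂T.P, ∀ᵐ θ ∂T.prior, θ ∈ B → liminf (fun n => g n (ω, θ)) atTop = ⊤ := by
    refine (Measure.ae_ae_comm
      (p := fun ω θ => θ ∈ B → liminf (fun n => g n (ω, θ)) atTop = ⊤) ?_).2
      (Eventually.of_forall fun θ => ?_)
    · have h1 : MeasurableSet {q : Ω × (∀ j, Θ j) | liminf (fun n => g n q) atTop = ⊤} :=
        Measurable.liminf hg (measurableSet_singleton ⊤)
      have h2 : MeasurableSet {q : Ω × (∀ j, Θ j) | q.2 ∈ B} := measurable_snd hB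
      exact h2.imp h1
    · by_cases hθ : θ ∈ B
      · filter_upwards [hpt θ hθ] with ω hω _ using hω
      · exact Eventually.of_forall fun ω h => absurd h hθ
  filter_upwards [hae] with ω hω
  have hmeas : ∀ n, Measurable fun θ => g n (ω, θ) := fun n => (hg n).comp measurable_prodMk_left
  -- Fatou's lemma on `B`
  have hF := lintegral_liminf_le (μ := T.prior.restrict B) (u := atTop) hmeas
  have hinf : ∫⁻ θ in B, liminf (fun n => g n (ω, θ)) atTop ∂T.prior = ⊤ := by
    rw [setLIntegral_congr_fun_ae hB hω]
    simp [ENNReal.top_mul hB0]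
  rw [hinf, top_le_iff] at hF
  have htB : Tendsto (fun n => ∫⁻ θ in B, g n (ω, θ) ∂T.prior) atTop (𝓝 ⊤) :=
    tendsto_of_le_liminf_of_limsup_le hF.ge le_top
  refine tendsto_nhds_top_mono htB (Eventually.of_forall fun n => ?_)
  exact (setLIntegral_le_lintegral _ _).trans_eq
    (lintegral_const_mul _ (hT.measurable_R_right n ω))

/-- On a fixed sieve, uniform equipartition bounds the exponential growth rate of the evidence of a set
on which `h ≥ b`. -/
theorem limsup_logEvidence_le {T : TestingProblem Ω Ξ κ m Θ} {G A : Set (∀ j, Θ j)}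
    (hG : MeasurableSet G) (hA : MeasurableSet A) {b δ : ℝ}
    (hb : ∀ᵐ θ ∂T.prior.restrict A, ENNReal.ofReal b ≤ T.h θ) {ω : Ω}
    (h1 : ∀ᶠ n : ℕ in atTop, ∀ θ ∈ G \ T.I,
      ENNReal.log (T.R n θ ω) / (n : EReal) ≤ -(T.h θ : EReal) + (δ : EReal))
    (h2 : ∀ᶠ n : ℕ in atTop, ∀ᵐ θ ∂T.prior, θ ∈ G ∩ T.I →
      ENNReal.log (T.R n θ ω) / (n : EReal) ≤ ((-b + δ : ℝ) : EReal)) :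
    limsup (fun n : ℕ => T.logEvidence (G ∩ A) n ω) atTop ≤ ((-b + δ : ℝ) : EReal) := by
  have := T.isProbabilityMeasure_prior
  refine limsup_le_of_le (by isBoundedDefault) ?_
  filter_upwards [h1, h2, eventually_gt_atTop 0] with n hn1 hn2 hn0
  refine (ennreal_log_div_le_iff hn0 _).2 ?_
  rw [ae_restrict_iff' hA] at hb
  have hle : ∀ᵐ θ ∂T.prior, θ ∈ G ∩ A →
      T.R n θ ω ≤ ENNReal.ofReal (Real.exp (n * (-b + δ))) := by
    filter_upwards [hn2, hb] with θ hθ2 hθb hθ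
    refine (ennreal_log_div_le_iff hn0 _).1 ?_
    by_cases hI : θ ∈ T.I
    · exact hθ2 ⟨hθ.1, hI⟩
    · refine (hn1 θ ⟨hθ.1, hI⟩).trans ?_
      rw [EReal.coe_add, EReal.coe_neg]
      refine add_le_add_left (EReal.neg_le_neg_iff.2 ?_) _
      calc (b : EReal) ≤ ((max b 0 : ℝ) : EReal) := EReal.coe_le_coe_iff.2 (le_max_left _ _)
        _ = ((ENNReal.ofReal b : ℝ≥0∞) : EReal) := EReal.coe_ennreal_ofReal.symm
        _ ≤ _ := EReal.coe_ennreal_le_coe_ennreal_iff.2 (hθb hθ.2)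
  calc ∫⁻ θ in G ∩ A, T.R n θ ω ∂T.prior
      ≤ ∫⁻ _ in G ∩ A, ENNReal.ofReal (Real.exp (n * (-b + δ))) ∂T.prior :=
        setLIntegral_mono_ae' (hG.inter hA) hle
    _ ≤ ENNReal.ofReal (Real.exp (n * (-b + δ))) := by
        rw [lintegral_const]
        exact mul_le_of_le_one_right' (by simpa using prob_le_one)

/-- If `h ≥ b` on a set `A` with `h(A) < ∞`, and `c < b` exceeds the minimal divergence rate only
slightly, then `e^{cn}` times the evidence of `A` tends to zero: outside the sieves because their
complements have exponentially small prior mass, inside because of the rate condition on `τ`. -/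
theorem Regular.exists_ae_tendsto_exp_mul_setLIntegral_R {T : TestingProblem Ω Ξ κ m Θ}
    (hT : T.Regular) {A : Set (∀ j, Θ j)} (hA : MeasurableSet A) (hAfin : T.hSet A < ⊤) {b : ℝ}
    (hb0 : T.hSet Set.univ < ENNReal.ofReal b)
    (hb : ∀ᵐ θ ∂T.prior.restrict A, ENNReal.ofReal b ≤ T.h θ) :
    ∃ c : ℝ, T.hSet Set.univ < ENNReal.ofReal c ∧ ∀ᵐ ω ∂T.P, Tendsto
      (fun n : ℕ => ENNReal.ofReal (Real.exp (n * c)) * ∫⁻ θ in A, T.R n θ ω ∂T.prior)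
      atTop (𝓝 0) := by
  have := T.isProbabilityMeasure_prior
  obtain ⟨G, a, ς, hGm, -, ha, hς, hGp, hU1, hU2, -, htau, -⟩ := hT.sieve
  have hς1 : T.hSet Set.univ < ENNReal.ofReal ς :=
    lt_of_le_of_lt (le_mul_of_one_le_left' one_le_two) hς
  obtain ⟨c', hc1, hc2⟩ := exists_between (lt_min hb0 hς1)
  have hc't : c' ≠ ⊤ := (hc2.trans_le (min_le_left _ _)).ne_top
  set c := c'.toReal
  have hcc : ENNReal.ofReal c = c' := ENNReal.ofReal_toReal hc't
  have hcb : c < b := (ENNReal.ofReal_lt_ofReal_iff_of_nonneg ENNReal.toReal_nonneg).1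
    (hcc.trans_lt <| hc2.trans_le (min_le_left _ _))
  have hcς : c < ς := (ENNReal.ofReal_lt_ofReal_iff_of_nonneg ENNReal.toReal_nonneg).1
    (hcc.trans_lt <| hc2.trans_le (min_le_right _ _))
  refine ⟨c, hcc ▸ hc1, ?_⟩
  -- outside the sieves
  have hout : ∀ᵐ ω ∂T.P, Tendsto (fun n : ℕ => ENNReal.ofReal (Real.exp (n * c)) *
      ∫⁻ θ in (G n)ᶜ, T.R n θ ω ∂T.prior) atTop (𝓝 0) := by
    refine ae_tendsto_zero_of_tsum_lintegral_ne_top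
      (fun n => ((hT.measurable_setLIntegral_R n _).const_mul _).aemeasurable) ?_
    refine ne_top_of_le_ne_top (tsum_ofReal_exp_neg_mul_ne_top (a := a) (sub_pos.2 hcς))
      (ENNReal.tsum_le_tsum fun n => ?_)
    rw [lintegral_const_mul _ (hT.measurable_setLIntegral_R n _)]
    have hGc : T.prior (G n)ᶜ ≤ ENNReal.ofReal (a * Real.exp (-(ς * n))) := by
      rw [← ofReal_measureReal, probReal_compl_eq_one_sub (hGm n)]
      exact ENNReal.ofReal_le_ofReal (by linarith [hGp n])
    calc _ ≤ ENNReal.ofReal (Real.exp (n * c)) * ENNReal.ofReal (a * Real.exp (-(ς * n))) :=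
          mul_le_mul_right ((hT.lintegral_setLIntegral_R_le n _).trans hGc) _
      _ = ENNReal.ofReal (a * Real.exp (-((ς - c) * n))) := by
          rw [← ENNReal.ofReal_mul (Real.exp_nonneg _), mul_left_comm, ← Real.exp_add]
          congr 3; ring
  -- inside the sieves; `δ` leaves the gap `-b + 2 * δ = -c - δ`
  set δ := (b - c) / 3 with hδd
  have hδ : 0 < δ := by rw [hδd]; linarith
  have hin : ∀ᵐ ω ∂T.P, Tendsto (fun n : ℕ => ENNReal.ofReal (Real.exp (n * c)) *
      ∫⁻ θ in G n ∩ A, T.R n θ ω ∂T.prior) atTop (𝓝 0) := by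
    filter_upwards [ae_all_iff.2 hU1, ae_all_iff.2 hU2, htau A hA hAfin δ hδ] with ω h1 h2 h3
    have h0 : Tendsto (fun n : ℕ => ENNReal.ofReal (1 * Real.exp (-(δ * n)))) atTop (𝓝 0) :=
      ENNReal.tendsto_atTop_zero_of_tsum_ne_top (tsum_ofReal_exp_neg_mul_ne_top hδ)
    refine tendsto_of_tendsto_of_tendsto_of_le_of_le' tendsto_const_nhds h0
      (Eventually.of_forall fun n => zero_le) ?_
    filter_upwards [h3, eventually_gt_atTop 0] with n hn hn0
    obtain ⟨t, ht, htn⟩ := sInf_lt_iff.1 hn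
    have hlim := limsup_logEvidence_le (hGm n) hA hb
      ((h1 n δ hδ).mono fun k hk θ hθ => (hk θ hθ).2) (h2 n (-b + δ))
    have hle : T.logEvidence (G n ∩ A) n ω ≤ ((-c - δ : ℝ) : EReal) := by
      refine (ht n htn).trans ((add_le_add_right hlim _).trans_eq ?_)
      rw [← EReal.coe_add, EReal.coe_eq_coe_iff, hδd]
      ring
    calc _ ≤ ENNReal.ofReal (Real.exp (n * c)) * ENNReal.ofReal (Real.exp (n * (-c - δ))) :=
          mul_le_mul_right ((ennreal_log_div_le_iff hn0 _).1 hle) _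
      _ = _ := by
          rw [← ENNReal.ofReal_mul (Real.exp_nonneg _), ← Real.exp_add]
          congr 1; rw [one_mul]; congr 1; ring
  filter_upwards [hout, hin] with ω h1 h2
  have h12 := h1.add h2
  rw [add_zero] at h12
  refine tendsto_of_tendsto_of_tendsto_of_le_of_le tendsto_const_nhds h12
    (fun n => zero_le) fun n => ?_
  simp only [← mul_add]
  refine mul_le_mul_right ((lintegral_mono_set ?_).trans (lintegral_union_le _ _ _)) _
  intro θ hθ
  by_cases h : θ ∈ G n
  · exact Or.inr ⟨h, hθ⟩
  · exact Or.inl h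

/-- Posterior consistency: a set of finite divergence rate on which `h` stays above the minimal rate
has asymptotically no posterior mass. -/
theorem Regular.ae_tendsto_posterior_zero {T : TestingProblem Ω Ξ κ m Θ}
    (hT : T.Regular) {A : Set (∀ j, Θ j)} (hA : MeasurableSet A) (hAfin : T.hSet A < ⊤) {b : ℝ}
    (hb0 : T.hSet Set.univ < ENNReal.ofReal b)
    (hb : ∀ᵐ θ ∂T.prior.restrict A, ENNReal.ofReal b ≤ T.h θ) :
    ∀ᵐ ω ∂T.P, Tendsto (fun n => T.posterior n ω A) atTop (𝓝 0) := by
  obtain ⟨c, hc, hlim⟩ := hT.exists_ae_tendsto_exp_mul_setLIntegral_R hA hAfin hb0 hb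
  filter_upwards [hlim, hT.ae_tendsto_exp_mul_lintegral_R hc,
    ae_all_iff.2 fun n => T.ae_posterior_eq_div n] with ω h1 h2 h3
  have h := ENNReal.Tendsto.div h1 (Or.inr ENNReal.top_ne_zero) h2 (Or.inr ENNReal.zero_ne_top)
  rw [ENNReal.zero_div] at h
  refine h.congr fun n => ?_
  rw [h3 n A hA, ENNReal.mul_div_mul_left _ _
    (by simpa using Real.exp_pos _) ENNReal.ofReal_ne_top]

theorem Regular.ae_eventually_isProbabilityMeasure_posterior {T : TestingProblem Ω Ξ κ m Θ}
    (hT : T.Regular) : ∀ᵐ ω ∂T.P, ∀ᶠ n in atTop, IsProbabilityMeasure (T.posterior n ω) := by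
  obtain ⟨c, hc1, hc2⟩ := exists_between hT.hSet_univ_ne_top.lt_top
  rw [← ENNReal.ofReal_toReal hc2.ne] at hc1
  filter_upwards [hT.ae_tendsto_exp_mul_lintegral_R hc1, hT.ae_lintegral_R_ne_top,
    ae_all_iff.2 fun n => T.ae_posterior_eq_div n] with ω h1 h2 h3
  filter_upwards [h1.eventually_const_lt ENNReal.zero_lt_top] with n hn
  refine ⟨?_⟩
  rw [h3 n _ MeasurableSet.univ, setLIntegral_univ]
  exact ENNReal.div_self (right_ne_zero_of_mul hn.ne') (h2 n)

/-! ### Convergence of the posterior probabilities to the true decision -/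

theorem measurableSet_cell (T : TestingProblem Ω Ξ κ m Θ) (d : Fin m → Bool) :
    MeasurableSet (T.cell d) := by
  simp only [cell, Set.ofPred_forall]
  refine MeasurableSet.iInter fun i => ?_
  by_cases hd : d i = true
  · simpa [hd] using T.measurableSet_altSet i
  · have h : {θ | d i = true ↔ θ ∈ T.altSet i} = (T.altSet i)ᶜ := by
      ext θ
      simp [hd]
    exact h ▸ (T.measurableSet_altSet i).compl

theorem altSet_subset_compl_cell (T : TestingProblem Ω Ξ κ m Θ) {d : Fin m → Bool} {i : Fin m}
    (hi : d i = false) : T.altSet i ⊆ (T.cell d)ᶜ := fun θ hθ hc => by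
  have := (hc i).2 hθ
  simp [hi] at this

theorem compl_altSet_subset_compl_cell (T : TestingProblem Ω Ξ κ m Θ) {d : Fin m → Bool} {i : Fin m}
    (hi : d i = true) : (T.altSet i)ᶜ ⊆ (T.cell d)ᶜ := fun _ hθ hc => hθ ((hc i).1 hi)

theorem Regular.JSet_univ_eq_zero {T : TestingProblem Ω Ξ κ m Θ} (hT : T.Regular) :
    T.JSet Set.univ = 0 := by
  by_contra h0
  have h1 : ∀ᵐ θ ∂T.prior.restrict Set.univ, T.hSet Set.univ + T.JSet Set.univ ≤ T.h θ := by
    filter_upwards [ae_essInf_le (f := fun θ => T.h θ - T.hSet Set.univ)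
      (μ := T.prior.restrict Set.univ)] with θ hθ
    have hθ' : T.JSet Set.univ ≤ T.h θ - T.hSet Set.univ := hθ
    have hpos : T.hSet Set.univ < T.h θ := tsub_pos_iff_lt.1 ((pos_iff_ne_zero.2 h0).trans_le hθ')
    calc _ ≤ T.hSet Set.univ + (T.h θ - T.hSet Set.univ) := add_le_add_right hθ' _
      _ = T.h θ := add_tsub_cancel_of_le hpos.le
  have h2 : T.hSet Set.univ + T.JSet Set.univ ≤ T.hSet Set.univ := le_essInf_of_ae_le _ h1
  exact (ENNReal.lt_add_right hT.hSet_univ_ne_top h0).not_ge h2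

/-- Outside the cell of the true decision the divergence rate is bounded away from its minimum: there
are only finitely many other cells, and none of them attains the minimum. -/
theorem Regular.exists_forall_ae_le_h {T : TestingProblem Ω Ξ κ m Θ} (hT : T.Regular)
    {dt : Fin m → Bool} (hdt : T.IsTrueDecision dt) :
    ∃ b : ℝ, T.hSet Set.univ < ENNReal.ofReal b ∧
      ∀ᵐ θ ∂T.prior.restrict (T.cell dt)ᶜ, ENNReal.ofReal b ≤ T.h θ := by
  have hpos : ∀ d ≠ dt, 0 < T.JSet (T.cell d) := fun d hd => by
    rw [pos_iff_ne_zero, ← hT.JSet_univ_eq_zero]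
    exact fun h => hd ((hdt d).1 h)
  obtain ⟨e, he, he1, hle⟩ : ∃ e : ℝ≥0∞, 0 < e ∧ e ≤ 1 ∧ ∀ d ≠ dt, e ≤ T.JSet (T.cell d) := by
    refine ⟨min ((Finset.univ.filter (· ≠ dt)).inf fun d => T.JSet (T.cell d)) 1,
      lt_min ((Finset.lt_inf_iff ENNReal.zero_lt_top).2 fun d hd =>
        hpos d (Finset.mem_filter.1 hd).2) one_pos, min_le_right _ _, fun d hd => ?_⟩
    exact (min_le_left _ _).trans
      (Finset.inf_le (f := fun d => T.JSet (T.cell d))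
        (Finset.mem_filter.2 ⟨Finset.mem_univ d, hd⟩))
  have hb : T.hSet Set.univ + e ≠ ⊤ :=
    ENNReal.add_ne_top.2 ⟨hT.hSet_univ_ne_top, (he1.trans_lt ENNReal.one_lt_top).ne⟩
  refine ⟨(T.hSet Set.univ + e).toReal, ?_, ?_⟩
  · rw [ENNReal.ofReal_toReal hb]
    exact ENNReal.lt_add_right hT.hSet_univ_ne_top he.ne'
  rw [ENNReal.ofReal_toReal hb, ae_restrict_iff' (T.measurableSet_cell dt).compl]
  have hall : ∀ᵐ θ ∂T.prior, ∀ d, θ ∈ T.cell d →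
      T.JSet (T.cell d) ≤ T.h θ - T.hSet Set.univ := by
    refine ae_all_iff.2 fun d => (ae_restrict_iff' (T.measurableSet_cell d)).1 ?_
    exact ae_essInf_le (f := fun θ => T.h θ - T.hSet Set.univ)
      (μ := T.prior.restrict (T.cell d))
  classical
  filter_upwards [hall] with θ hθ hθc
  obtain ⟨d, hmem⟩ : ∃ d, θ ∈ T.cell d :=
    ⟨fun i => decide (θ ∈ T.altSet i), fun i => decide_eq_true_iff⟩
  have hne : d ≠ dt := fun h => hθc (h ▸ hmem)
  have h1 : e ≤ T.h θ - T.hSet Set.univ := (hle d hne).trans (hθ d hmem)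
  have h2 : T.hSet Set.univ < T.h θ := tsub_pos_iff_lt.1 (he.trans_le h1)
  calc T.hSet Set.univ + e ≤ T.hSet Set.univ + (T.h θ - T.hSet Set.univ) := add_le_add_right h1 _
    _ = T.h θ := add_tsub_cancel_of_le h2.le

theorem hSet_anti (T : TestingProblem Ω Ξ κ m Θ) {A B : Set (∀ j, Θ j)} (h : A ⊆ B) :
    T.hSet B ≤ T.hSet A :=
  essInf_antitone_measure (Measure.restrict_mono h le_rfl).absolutelyContinuous

theorem posterior_le_one (T : TestingProblem Ω Ξ κ m Θ) (n : ℕ) (ω : Ω) (A : Set (∀ j, Θ j)) :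
    T.posterior n ω A ≤ 1 := by
  refine (measure_mono (Set.subset_univ A)).trans ?_
  rw [posterior, Measure.smul_apply, withDensity_apply _ MeasurableSet.univ, setLIntegral_univ,
    smul_eq_mul, mul_comm, ← div_eq_mul_inv]
  exact ENNReal.div_self_le_one

theorem v_mem_Icc (T : TestingProblem Ω Ξ κ m Θ) (n : ℕ) (i : Fin m) (ω : Ω) :
    T.v n i ω ∈ Set.Icc (0 : ℝ) 1 :=
  ⟨measureReal_nonneg, ENNReal.toReal_mono ENNReal.one_ne_top (T.posterior_le_one n ω _)⟩

theorem Regular.aemeasurable_v {T : TestingProblem Ω Ξ κ m Θ} (hT : T.Regular) (n : ℕ) :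
    AEMeasurable (fun ω i => T.v n i ω) T.P := by
  refine aemeasurable_pi_lambda _ fun i => ?_
  have h := (hT.measurable_setLIntegral_R n (T.altSet i)).div
    (hT.measurable_setLIntegral_R n Set.univ)
  refine ⟨_, h.ennreal_toReal, ?_⟩
  filter_upwards [T.ae_posterior_eq_div n] with ω hω
  simp only [v, measureReal_def, hω _ (T.measurableSet_altSet i), Measure.restrict_univ]
  rfl

/-- Almost surely the posterior probabilities of the alternatives converge to the true decision. The
set to which posterior consistency applies is the complement of the true cell; it has finite divergence
rate because it contains the alternative of a true null. -/
theorem Regular.ae_tendsto_v {T : TestingProblem Ω Ξ κ m Θ} (hT : T.Regular)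
    {dt : Fin m → Bool} (hdt : T.IsTrueDecision dt) {j : Fin m} (hj : dt j = false)
    (hfin : T.hSet (T.altSet j) < ⊤) (i : Fin m) :
    ∀ᵐ ω ∂T.P, Tendsto (fun n => T.v n i ω) atTop (𝓝 (if dt i then 1 else 0)) := by
  obtain ⟨b, hb0, hb⟩ := hT.exists_forall_ae_le_h hdt
  filter_upwards [hT.ae_tendsto_posterior_zero (T.measurableSet_cell dt).compl
    ((T.hSet_anti (T.altSet_subset_compl_cell hj)).trans_lt hfin) hb0 hb,
    hT.ae_eventually_isProbabilityMeasure_posterior] with ω h1 h2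
  have h3 : ∀ A ⊆ (T.cell dt)ᶜ, Tendsto (fun n => (T.posterior n ω).real A) atTop (𝓝 0) := by
    intro A hA
    exact (ENNReal.tendsto_toReal ENNReal.zero_ne_top).comp
      (tendsto_of_tendsto_of_tendsto_of_le_of_le tendsto_const_nhds h1 (fun n => zero_le)
        fun n => measure_mono hA)
  by_cases hi : dt i = true
  · have h4 := (h3 _ (T.compl_altSet_subset_compl_cell hi)).const_sub 1
    rw [sub_zero] at h4
    simp only [hi, if_true]
    refine h4.congr' ?_
    filter_upwards [h2] with n hn
    rw [probReal_compl_eq_one_sub (T.measurableSet_altSet i), sub_sub_cancel]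
    rfl
  · simp only [hi, Bool.false_eq_true, if_false]
    exact h3 _ (T.altSet_subset_compl_cell (by simpa using hi))

end TestingProblem

/-! ### The false discovery rate as a function of the threshold -/

theorem integral_le_integral_add_measureReal {α : Type*} [MeasurableSpace α] {μ : Measure α}
    [IsFiniteMeasure μ] {f g : α → ℝ} {S : Set α} (hf : Integrable f μ) (hg : Integrable g μ)
    (hS : MeasurableSet S) (h : ∀ᵐ x ∂μ, f x ≤ g x + S.indicator (fun _ => (1 : ℝ)) x) :
    ∫ x, f x ∂μ ≤ ∫ x, g x ∂μ + μ.real S := by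
  have hi : Integrable (S.indicator fun _ => (1 : ℝ)) μ := (integrable_const 1).indicator hS
  calc ∫ x, f x ∂μ ≤ ∫ x, (g x + S.indicator (fun _ => (1 : ℝ)) x) ∂μ :=
        integral_mono_ae hf (hg.add hi) h
    _ = ∫ x, g x ∂μ + μ.real S := by
        rw [integral_add hg hi, integral_indicator hS]; simp

/-- The posterior false discovery rate as a function of the vector `x` of posterior probabilities of
the alternatives, when the hypotheses with `x i > β` are rejected. -/
noncomputable def thresholdFDR {m : ℕ} (β : ℝ) (x : Fin m → ℝ) : ℝ :=
  (∑ i, if β < x i then 1 - x i else 0) / max (∑ i, if β < x i then (1 : ℝ) else 0) 1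

section thresholdFDR

variable {m : ℕ}

theorem measurable_thresholdFDR (β : ℝ) : Measurable (thresholdFDR (m := m) β) := by
  have hi : ∀ i : Fin m, MeasurableSet {x : Fin m → ℝ | β < x i} := fun i =>
    measurableSet_lt measurable_const (measurable_pi_apply i)
  refine Measurable.div (Finset.measurable_sum _ fun i _ => ?_)
    ((Finset.measurable_sum _ fun i _ => ?_).max measurable_const)
  · exact Measurable.ite (hi i) (measurable_const.sub (measurable_pi_apply i)) measurable_const
  · exact Measurable.ite (hi i) measurable_const measurable_const

theorem thresholdFDR_nonneg {β : ℝ} {x : Fin m → ℝ} (hx : ∀ i, x i ∈ Set.Icc (0 : ℝ) 1) :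
    0 ≤ thresholdFDR β x := by
  refine div_nonneg (Finset.sum_nonneg fun i _ => ?_) (zero_le_one.trans (le_max_right _ _))
  split_ifs
  · linarith [(hx i).2]
  · exact le_rfl

theorem thresholdFDR_le_of_forall {β η : ℝ} {x : Fin m → ℝ} (hη : 0 ≤ η)
    (h : ∀ i, β < x i → 1 - x i ≤ η) : thresholdFDR β x ≤ η := by
  refine (div_le_iff₀ (zero_lt_one.trans_le (le_max_right _ _))).2 ?_
  calc ∑ i, (if β < x i then 1 - x i else 0) ≤ ∑ i, η * (if β < x i then (1 : ℝ) else 0) := by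
        refine Finset.sum_le_sum fun i _ => ?_
        split_ifs with hi
        · simpa using h i hi
        · simp
    _ ≤ _ := by
        rw [← Finset.mul_sum]
        exact mul_le_mul_of_nonneg_left (le_max_left _ _) hη

theorem thresholdFDR_le_one {β : ℝ} {x : Fin m → ℝ} (hx : ∀ i, x i ∈ Set.Icc (0 : ℝ) 1) :
    thresholdFDR β x ≤ 1 :=
  thresholdFDR_le_of_forall zero_le_one fun i _ => by linarith [(hx i).1]

/-- If everything is rejected and the true nulls have small posterior probability of the alternative,
then the false discovery rate is about the proportion of true nulls. -/
theorem le_thresholdFDR_of_forall_lt {β η : ℝ} {x : Fin m → ℝ} {d : Fin m → Bool} (hm : 0 < m)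
    (hx : ∀ i, x i ∈ Set.Icc (0 : ℝ) 1) (hη : 0 ≤ η) (hβ : ∀ i, β < x i)
    (h : ∀ i, d i = false → x i ≤ η) :
    (TestingProblem.numTrueNulls d : ℝ) / m - η ≤ thresholdFDR β x := by
  have hm' : (1 : ℝ) ≤ m := by exact_mod_cast hm
  have hle : (TestingProblem.numTrueNulls d : ℝ) ≤ m := by
    exact_mod_cast (Finset.card_filter_le _ _).trans_eq (Finset.card_fin m)
  have h1 : (TestingProblem.numTrueNulls d : ℝ) * (1 - η) ≤ ∑ i, (1 - x i) := by
    calc (TestingProblem.numTrueNulls d : ℝ) * (1 - η)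
        = ∑ i ∈ Finset.univ.filter (fun i => d i = false), (1 - η) := by
          rw [Finset.sum_const, nsmul_eq_mul]; rfl
      _ ≤ ∑ i ∈ Finset.univ.filter (fun i => d i = false), (1 - x i) :=
          Finset.sum_le_sum fun i hi => by linarith [h i (Finset.mem_filter.1 hi).2]
      _ ≤ ∑ i, (1 - x i) :=
          Finset.sum_le_sum_of_subset_of_nonneg (Finset.filter_subset _ _)
            fun i _ _ => by linarith [(hx i).2]
  have h2 : thresholdFDR β x = (∑ i, (1 - x i)) / m := by
    simp only [thresholdFDR, hβ, if_true, Finset.sum_const, Finset.card_univ, Fintype.card_fin,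
      nsmul_eq_mul, mul_one, max_eq_left hm']
  rw [h2, sub_le_iff_le_add, div_le_iff₀ (by linarith), add_mul, div_mul_cancel₀ _ (by linarith)]
  nlinarith

theorem thresholdFDR_congr {β β' : ℝ} {x : Fin m → ℝ} (h : ∀ i, β < x i ↔ β' < x i) :
    thresholdFDR β x = thresholdFDR β' x := by
  simp only [thresholdFDR, h]

theorem measurableSet_exists_mem {S : Fin m → Set ℝ} (hS : ∀ i, MeasurableSet (S i)) :
    MeasurableSet {x : Fin m → ℝ | ∃ i, x i ∈ S i} := by
  simp only [Set.ofPred_exists]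
  exact MeasurableSet.iUnion fun i => measurable_pi_apply i (hS i)

theorem measureReal_exists_mem_le {μ : Measure (Fin m → ℝ)} (S : Fin m → Set ℝ) :
    μ.real {x : Fin m → ℝ | ∃ i, x i ∈ S i} ≤ ∑ i, μ.real {x | x i ∈ S i} := by
  simp only [Set.ofPred_exists]
  exact measureReal_iUnion_fintype_le _

variable {μ : Measure (Fin m → ℝ)} [IsProbabilityMeasure μ]

theorem integrable_thresholdFDR (h01 : ∀ᵐ x ∂μ, ∀ i, x i ∈ Set.Icc (0 : ℝ) 1) (β : ℝ) :
    Integrable (thresholdFDR β) μ := by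
  refine Integrable.of_bound (measurable_thresholdFDR β).aestronglyMeasurable 1 ?_
  filter_upwards [h01] with x hx
  rw [Real.norm_of_nonneg (thresholdFDR_nonneg hx)]
  exact thresholdFDR_le_one hx

theorem integral_thresholdFDR_le (h01 : ∀ᵐ x ∂μ, ∀ i, x i ∈ Set.Icc (0 : ℝ) 1) (β : ℝ) :
    ∫ x, thresholdFDR β x ∂μ ≤ μ.real {x | ∃ i, β < x i} := by
  have h := integral_le_integral_add_measureReal (g := fun _ => (0 : ℝ))
    (S := {x : Fin m → ℝ | ∃ i, β < x i}) (integrable_thresholdFDR h01 β) (integrable_const _)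
    (measurableSet_exists_mem fun _ => measurableSet_Ioi) (by
      filter_upwards [h01] with x hx
      by_cases hxS : x ∈ {x : Fin m → ℝ | ∃ i, β < x i}
      · rw [Set.indicator_of_mem hxS, zero_add]
        exact thresholdFDR_le_one hx
      · rw [Set.indicator_of_notMem hxS, add_zero]
        exact thresholdFDR_le_of_forall le_rfl fun i hi => absurd ⟨i, hi⟩ hxS)
  simpa using h

/-- Moving the threshold changes the expected false discovery rate by at most the mass that it sweeps,
so the intermediate value theorem holds up to atoms of the marginal laws. -/
theorem exists_abs_integral_thresholdFDR_sub_le (h01 : ∀ᵐ x ∂μ, ∀ i, x i ∈ Set.Icc (0 : ℝ) 1)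
    {a b α : ℝ} (hab : a ≤ b) (ha : α ≤ ∫ x, thresholdFDR a x ∂μ)
    (hb : ∫ x, thresholdFDR b x ∂μ ≤ α) :
    ∃ s ∈ Set.Icc a b, |∫ x, thresholdFDR s x ∂μ - α| ≤ ∑ i, μ.real {x | x i = s} := by
  set Q : Measure ℝ := ∑ i, μ.map fun x => x i
  have hQ : ∀ S, MeasurableSet S → Q.real S = ∑ i, μ.real {x | x i ∈ S} := by
    intro S hS
    simp only [Q, measureReal_def, Measure.coe_finsetSum, Finset.sum_apply]
    rw [ENNReal.toReal_sum fun i _ => measure_ne_top _ _]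
    refine Finset.sum_congr rfl fun i _ => ?_
    rw [Measure.map_apply (measurable_pi_apply i) hS]
    rfl
  have hsweep : ∀ x y : ℝ, x ≤ y → |∫ z, thresholdFDR x z ∂μ - ∫ z, thresholdFDR y z ∂μ| ≤
      Q.real (Set.Ioc x y) := by
    intro x y hxy
    rw [hQ _ measurableSet_Ioc]
    refine le_trans ?_ (measureReal_exists_mem_le (μ := μ) fun _ => Set.Ioc x y)
    have hS := measurableSet_exists_mem (m := m) fun _ => measurableSet_Ioc (a := x) (b := y)
    have hcong : ∀ z : Fin m → ℝ, z ∉ {x' : Fin m → ℝ | ∃ i, x' i ∈ Set.Ioc x y} →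
        thresholdFDR x z = thresholdFDR y z := fun z hz => thresholdFDR_congr fun i =>
      ⟨fun h => not_le.1 fun h' => hz ⟨i, h, h'⟩, fun h => hxy.trans_lt h⟩
    have key : ∀ c c' : ℝ, (∀ z : Fin m → ℝ, z ∉ {x' : Fin m → ℝ | ∃ i, x' i ∈ Set.Ioc x y} →
        thresholdFDR c z = thresholdFDR c' z) → ∫ z, thresholdFDR c z ∂μ ≤
        ∫ z, thresholdFDR c' z ∂μ + μ.real {x' : Fin m → ℝ | ∃ i, x' i ∈ Set.Ioc x y} := by
      intro c c' h
      refine integral_le_integral_add_measureReal (integrable_thresholdFDR h01 c)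
        (integrable_thresholdFDR h01 c') hS ?_
      filter_upwards [h01] with z hz
      by_cases hzS : z ∈ {x' : Fin m → ℝ | ∃ i, x' i ∈ Set.Ioc x y}
      · rw [Set.indicator_of_mem hzS]
        linarith [thresholdFDR_le_one (β := c) hz, thresholdFDR_nonneg (β := c') hz]
      · rw [Set.indicator_of_notMem hzS, h z hzS, add_zero]
    have h1 := key x y hcong
    have h2 := key y x fun z hz => (hcong z hz).symm
    exact abs_le.2 ⟨by linarith, by linarith⟩
  obtain ⟨s, hs, h⟩ := exists_abs_sub_le_measureReal_singleton Q hsweep hab ha hb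
  exact ⟨s, hs, by simpa [hQ _ (measurableSet_singleton s)] using h⟩

theorem tendsto_measureReal_exists_le (μ : Measure (Fin m → ℝ)) [IsProbabilityMeasure μ] :
    Tendsto (fun k : ℕ => μ.real {x | ∃ i, x i ≤ 1 / ((k : ℝ) + 1)}) atTop
      (𝓝 (μ.real {x | ∃ i, x i ≤ 0})) := by
  have hI : (⋂ k : ℕ, {x : Fin m → ℝ | ∃ i, x i ≤ 1 / ((k : ℝ) + 1)}) = {x | ∃ i, x i ≤ 0} := by
    ext x
    simp only [Set.mem_iInter, Set.mem_ofPred_eq]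
    refine ⟨fun h => ?_, fun ⟨i, hi⟩ k => ⟨i, hi.trans (by positivity)⟩⟩
    by_contra! h0
    obtain ⟨k, hk⟩ := (eventually_all.2 fun i =>
      (tendsto_one_div_add_atTop_nhds_zero_nat (𝕜 := ℝ)).eventually_lt_const (h0 i)).exists
    obtain ⟨i, hi⟩ := h k
    exact hi.not_gt (hk i)
  rw [← hI]
  refine (ENNReal.tendsto_toReal (measure_ne_top _ _)).comp
    (tendsto_measure_iInter_atTop (fun k => (measurableSet_exists_mem
      fun _ => measurableSet_Iic).nullMeasurableSet) ?_ ⟨0, measure_ne_top _ _⟩)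
  exact fun j k hjk x ⟨i, hi⟩ => ⟨i, hi.trans
    (one_div_le_one_div_of_le (by positivity) (by gcongr))⟩

end thresholdFDR

/-- Consider laws `μ n` on `[0, 1]^m` that concentrate at the indicator of a decision `d`, with
asymptotically no atoms in the coordinates of the true nulls. Then every `α` between `0` and the
proportion of true nulls is approximately the expected false discovery rate for some small threshold,
while some rejection occurs with probability close to one. -/
theorem eventually_exists_threshold {m : ℕ} {μ : ℕ → Measure (Fin m → ℝ)}
    [∀ n, IsProbabilityMeasure (μ n)] {d : Fin m → Bool}
    (h01 : ∀ n, ∀ᵐ x ∂μ n, ∀ i, x i ∈ Set.Icc (0 : ℝ) 1)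
    (hconv : ∀ i, ∀ η : ℝ, 0 < η →
      Tendsto (fun n => (μ n).real {x | η ≤ |x i - if d i then 1 else 0|}) atTop (𝓝 0))
    (hatom : ∀ i, d i = false → Tendsto (fun n => ⨆ s : ℝ, μ n {x | x i = s}) atTop (𝓝 0))
    (hm : TestingProblem.numTrueNulls d < m) {α : ℝ} (hα : 0 < α)
    (hα' : α < (TestingProblem.numTrueNulls d : ℝ) / m) {ε : ℝ} (hε : 0 < ε) :
    ∀ᶠ n in atTop, ∃ β, 0 < β ∧ β < 1 ∧ β < ε ∧ |∫ x, thresholdFDR β x ∂μ n - α| < ε ∧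
      1 - ε < (μ n).real {x | ∃ i, β < x i} := by
  set q : ℝ := (TestingProblem.numTrueNulls d : ℝ) / m
  have hm0 : 0 < m := (Nat.zero_le _).trans_lt hm
  obtain ⟨i₀, hi₀⟩ : ∃ i, d i = true := by
    by_contra! h
    refine hm.ne ?_
    rw [TestingProblem.numTrueNulls, Finset.filter_true_of_mem fun i _ => by simpa using h i,
      Finset.card_univ, Fintype.card_fin]
  -- total mass of the atoms at a point below `1 / 2`; the coordinates of false nulls contribute
  -- little there because they concentrate at `1`
  obtain ⟨r, hr0, hr⟩ : ∃ r : ℕ → ℝ, Tendsto r atTop (𝓝 0) ∧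
      ∀ n s, s < 1 / 2 → ∑ i, (μ n).real {x | x i = s} ≤ r n := by
    refine ⟨fun n => ∑ i, if d i then (μ n).real {x | 1 / 2 ≤ |x i - if d i then 1 else 0|}
      else (⨆ s : ℝ, μ n {x | x i = s}).toReal, ?_, fun n s hs => Finset.sum_le_sum fun i _ => ?_⟩
    · rw [show 𝓝 (0 : ℝ) = 𝓝 (∑ _i : Fin m, 0) by rw [Finset.sum_const_zero]]
      refine tendsto_finsetSum _ fun i _ => ?_
      split_ifs with hi
      · simpa [hi] using hconv i (1 / 2) (by norm_num)
      · exact (ENNReal.tendsto_toReal ENNReal.zero_ne_top).comp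
          (hatom i (by simpa using hi))
    · split_ifs with hi
      · refine measureReal_mono fun x (hx : x i = s) => ?_
        rw [Set.mem_ofPred_eq, hx, abs_sub_comm]
        exact (by linarith : (1 : ℝ) / 2 ≤ 1 - s).trans (le_abs_self _)
      · exact ENNReal.toReal_mono (ne_top_of_le_ne_top ENNReal.one_ne_top
          (iSup_le fun s => prob_le_one)) (le_iSup (fun s : ℝ => μ n {x | x i = s}) s)
  -- the event that some coordinate is far from its limit
  set E : ℝ → Set (Fin m → ℝ) := fun η => {x | ∃ i, x i ∈ {y : ℝ | η ≤ |y - if d i then 1 else 0|}}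
  have hEm : ∀ η, MeasurableSet (E η) := fun η => measurableSet_exists_mem fun i =>
    measurableSet_le measurable_const (measurable_id.sub_const _).abs
  have hE : ∀ η : ℝ, 0 < η → Tendsto (fun n => (μ n).real (E η)) atTop (𝓝 0) := by
    intro η hη
    have := tendsto_finsetSum Finset.univ fun i _ => hconv i η hη
    rw [Finset.sum_const_zero] at this
    exact squeeze_zero (fun n => measureReal_nonneg)
      (fun n => measureReal_exists_mem_le _) this
  set b : ℝ := min (ε / 2) (1 / 4)
  have hb0 : 0 < b := lt_min (by linarith) (by norm_num)
  have hbε : b < ε := (min_le_left _ _).trans_lt (half_lt_self hε)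
  have hb4 : b ≤ 1 / 4 := min_le_right _ _
  -- at the threshold `b` the false discovery rate is small
  have hup : ∀ᶠ n in atTop, ∫ x, thresholdFDR b x ∂μ n ≤ α := by
    have hη : 0 < min b (α / 2) := lt_min hb0 (half_pos hα)
    filter_upwards [(hE _ hη).eventually_lt_const (half_pos hα)] with n hn
    have h := integral_le_integral_add_measureReal (g := fun _ => min b (α / 2))
      (integrable_thresholdFDR (h01 n) b) (integrable_const _) (hEm (min b (α / 2))) (by
        filter_upwards [h01 n] with x hx
        by_cases hxE : x ∈ E (min b (α / 2))
        · rw [Set.indicator_of_mem hxE]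
          linarith [thresholdFDR_le_one (β := b) hx]
        · rw [Set.indicator_of_notMem hxE, add_zero]
          refine thresholdFDR_le_of_forall hη.le fun i hi => ?_
          have hxi : |x i - if d i then 1 else 0| < min b (α / 2) :=
            not_le.1 fun h => hxE ⟨i, h⟩
          split_ifs at hxi
          · linarith [(abs_lt.1 hxi).1]
          · linarith [(abs_lt.1 hxi).2, min_le_left b (α / 2)])
    rw [integral_const, probReal_univ, one_smul] at h
    linarith [min_le_right b (α / 2)]
  -- for tiny thresholds everything is rejected
  have hlow : ∀ᶠ n in atTop, ∃ a, 0 < a ∧ a < b ∧ α ≤ ∫ x, thresholdFDR a x ∂μ n := by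
    have hg : 0 < (q - α) / 2 := by linarith
    filter_upwards [(hE _ hg).eventually_lt_const (half_pos hg),
      hr0.eventually_lt_const (half_pos hg)] with n hn1 hn2
    have hzero : (μ n).real {x | ∃ i, x i ≤ 0} < (q - α) / 2 / 2 := by
      refine lt_of_le_of_lt ?_ hn2
      refine le_trans ?_ (hr n 0 (by norm_num))
      refine le_trans (le_of_eq ?_) (measureReal_exists_mem_le fun _ => {(0 : ℝ)})
      refine measureReal_congr ?_
      filter_upwards [h01 n] with x hx
      exact propext ⟨fun ⟨i, hi⟩ => ⟨i, le_antisymm hi (hx i).1⟩, fun ⟨i, hi⟩ => ⟨i, le_of_eq hi⟩⟩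
    obtain ⟨k, hk1, hk2⟩ := (((tendsto_measureReal_exists_le (μ n)).eventually_lt_const hzero).and
      ((tendsto_one_div_add_atTop_nhds_zero_nat (𝕜 := ℝ)).eventually_lt_const hb0)).exists
    refine ⟨1 / ((k : ℝ) + 1), by positivity, hk2, ?_⟩
    set a : ℝ := 1 / ((k : ℝ) + 1)
    have hSm : MeasurableSet {x : Fin m → ℝ | ∃ i, x i ≤ a} :=
      measurableSet_exists_mem fun _ => measurableSet_Iic
    have hq1 : q ≤ 1 := by
      refine div_le_one_of_le₀ ?_ (Nat.cast_nonneg _)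
      exact_mod_cast hm.le
    have h := integral_le_integral_add_measureReal (μ := μ n) (f := fun _ => q - (q - α) / 2)
      (integrable_const _) (integrable_thresholdFDR (h01 n) a)
      ((hEm ((q - α) / 2)).union hSm) (by
        filter_upwards [h01 n] with x hx
        by_cases hxE : x ∈ E ((q - α) / 2) ∪ {x : Fin m → ℝ | ∃ i, x i ≤ a}
        · rw [Set.indicator_of_mem hxE]
          linarith [thresholdFDR_nonneg (β := a) hx]
        · rw [Set.indicator_of_notMem hxE, add_zero]
          refine le_thresholdFDR_of_forall_lt hm0 hx hg.le
            (fun i => not_le.1 fun h => hxE (Or.inr ⟨i, h⟩)) fun i hi => ?_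
          have hxi : |x i - if d i then 1 else 0| < (q - α) / 2 :=
            not_le.1 fun h => hxE (Or.inl ⟨i, h⟩)
          simp only [hi, Bool.false_eq_true, if_false, sub_zero] at hxi
          exact (abs_lt.1 hxi).2.le)
    rw [integral_const, probReal_univ, one_smul] at h
    linarith [measureReal_union_le (μ := μ n) (E ((q - α) / 2)) {x : Fin m → ℝ | ∃ i, x i ≤ a}]
  filter_upwards [hup, hlow, hr0.eventually_lt_const hε,
    (hE (1 / 2) (by norm_num)).eventually_lt_const hε] with n h1 ⟨a, ha0, hab, h2⟩ h3 h4
  obtain ⟨s, ⟨has, hsb⟩, hs⟩ := exists_abs_integral_thresholdFDR_sub_le (h01 n) hab.le h2 h1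
  refine ⟨s, ha0.trans_le has, by linarith, hsb.trans_lt hbε,
    (hs.trans (hr n s (by linarith))).trans_lt h3, ?_⟩
  have hcompl : {x : Fin m → ℝ | ∃ i, s < x i}ᶜ ⊆ E (1 / 2) := by
    intro x hx
    have hx' : x i₀ ≤ s := not_lt.1 fun h => hx ⟨i₀, h⟩
    refine ⟨i₀, ?_⟩
    simp only [hi₀, if_true, Set.mem_ofPred_eq]
    rw [abs_sub_comm]
    exact (by linarith : (1 : ℝ) / 2 ≤ 1 - x i₀).trans (le_abs_self _)
  have h5 := measureReal_mono (μ := μ n) hcompl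
  have hrej : MeasurableSet {x : Fin m → ℝ | ∃ i, s < x i} :=
    measurableSet_exists_mem fun _ => measurableSet_Ioi
  rw [probReal_compl_eq_one_sub hrej] at h5
  linarith

/-! ### The positive Bayesian false discovery rate -/

namespace TestingProblem

variable {Ω Ξ κ : Type*} [MeasurableSpace Ω] [MeasurableSpace Ξ] {m : ℕ}
  {Θ : Fin m ⊕ κ → Type*} [∀ j, MeasurableSpace (Θ j)]

theorem posteriorFDR_eq_thresholdFDR (T : TestingProblem Ω Ξ κ m Θ) (n : ℕ) (β : ℝ) (ω : Ω) :
    T.posteriorFDR n β ω = thresholdFDR β fun i => T.v n i ω := by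
  simp only [posteriorFDR, thresholdFDR, decision, additiveRule, v, decide_eq_true_eq]
  congr!

theorem mem_someRejection_iff (T : TestingProblem Ω Ξ κ m Θ) (n : ℕ) (β : ℝ) (ω : Ω) :
    ω ∈ T.someRejection n β ↔ ∃ i, β < T.v n i ω := by
  simp only [someRejection, Set.mem_ofPred_eq, ne_eq, funext_iff, decision, additiveRule,
    decide_eq_false_iff_not, not_forall, not_not, v]

theorem posteriorFDR_eq_zero_of_notMem (T : TestingProblem Ω Ξ κ m Θ) {n : ℕ} {β : ℝ} {ω : Ω}
    (h : ω ∉ T.someRejection n β) : T.posteriorFDR n β ω = 0 := by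
  rw [mem_someRejection_iff, not_exists] at h
  simp [posteriorFDR_eq_thresholdFDR, thresholdFDR, h]

/-- The positive Bayesian false discovery rate in terms of the law of the vector of posterior
probabilities: the unconditional expected rate divided by the probability of a rejection. -/
theorem Regular.pBFDR_eq_div {T : TestingProblem Ω Ξ κ m Θ} (hT : T.Regular) (n : ℕ) (β : ℝ) :
    T.pBFDR n β = (∫ x, thresholdFDR β x ∂T.P.map (fun ω i => T.v n i ω)) /
      (T.P.map fun ω i => T.v n i ω).real {x | ∃ i, β < x i} := by
  have hN : ∫ ω in T.someRejection n β, T.posteriorFDR n β ω ∂T.P =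
      ∫ x, thresholdFDR β x ∂T.P.map (fun ω i => T.v n i ω) := by
    rw [setIntegral_eq_integral_of_forall_compl_eq_zero
      fun ω hω => T.posteriorFDR_eq_zero_of_notMem hω, integral_map (hT.aemeasurable_v n)
      (measurable_thresholdFDR β).aestronglyMeasurable]
    simp only [posteriorFDR_eq_thresholdFDR]
  have hD : (T.P.map fun ω i => T.v n i ω).real {x | ∃ i, β < x i} =
      T.P.real (T.someRejection n β) := by
    have hrej : MeasurableSet {x : Fin m → ℝ | ∃ i, β < x i} :=
      measurableSet_exists_mem fun _ => measurableSet_Ioi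
    rw [measureReal_def, Measure.map_apply_of_aemeasurable (hT.aemeasurable_v n) hrej,
      measureReal_def]
    congr 2
    ext ω
    exact (T.mem_someRejection_iff n β ω).symm
  rw [pBFDR, ProbabilityTheory.cond, integral_smul_measure, hN, hD, ENNReal.toReal_inv, smul_eq_mul,
    measureReal_def, div_eq_inv_mul]

end TestingProblem

theorem mainTheorem8 {Ω Ξ κ : Type*} [MeasurableSpace Ω] [MeasurableSpace Ξ] {m : ℕ}
    {Θ : Fin m ⊕ κ → Type*} [∀ j, MeasurableSpace (Θ j)]
    (T : TestingProblem Ω Ξ κ m Θ) (hT : T.Regular)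
    (dt : Fin m → Bool) (hdt : T.IsTrueDecision dt)
    (hfin : ∀ i, dt i = false → T.hSet (T.altSet i) < ⊤)
    (hatom : ∀ i, dt i = false →
      Tendsto (fun n : ℕ => ⨆ x : ℝ, T.P {ω | T.v n i ω = x}) atTop (𝓝 0))
    (hm : TestingProblem.numTrueNulls dt < m)
    (α : ℝ) (hα : 0 < α) (hα' : α < (TestingProblem.numTrueNulls dt : ℝ) / (m : ℝ)) :
    ∃ β : ℕ → ℝ, (∀ n, 0 < β n ∧ β n < 1) ∧ Tendsto β atTop (𝓝 0) ∧
      (∀ᶠ n in atTop, 0 < T.P (T.someRejection n (β n))) ∧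
      Tendsto (fun n => T.pBFDR n (β n)) atTop (𝓝 α) := by
  have := T.isProbabilityMeasure_P
  -- a true null exists, since the proportion of true nulls exceeds `α > 0`
  obtain ⟨j, hj⟩ : ∃ j, dt j = false := by
    by_contra! h
    have h0 : TestingProblem.numTrueNulls dt = 0 := by
      rw [TestingProblem.numTrueNulls, Finset.filter_false_of_mem fun i _ => h i, Finset.card_empty]
    rw [h0, Nat.cast_zero, zero_div] at hα'
    exact hα.not_gt hα'
  have hv := hT.aemeasurable_v
  have hvi : ∀ n i, AEMeasurable (T.v n i) T.P := fun n i =>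
    (measurable_pi_apply i).comp_aemeasurable (hv n)
  -- the law of the vector of posterior probabilities of the alternatives
  set μ : ℕ → Measure (Fin m → ℝ) := fun n => T.P.map fun ω i => T.v n i ω with hμ
  have hμP : ∀ n, IsProbabilityMeasure (μ n) := fun n =>
    Measure.isProbabilityMeasure_map (hv n)
  have hmap : ∀ n i (S : Set ℝ), MeasurableSet S → μ n {x | x i ∈ S} = T.P {ω | T.v n i ω ∈ S} :=
    fun n i S hS => Measure.map_apply_of_aemeasurable (hv n) (measurable_pi_apply i hS)
  have h01 : ∀ n, ∀ᵐ x ∂μ n, ∀ i, x i ∈ Set.Icc (0 : ℝ) 1 := fun n =>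
    ae_all_iff.2 fun i => (ae_map_iff (hv n) (measurable_pi_apply i measurableSet_Icc)).2
      (Eventually.of_forall fun ω => T.v_mem_Icc n i ω)
  have hconv : ∀ i, ∀ η : ℝ, 0 < η →
      Tendsto (fun n => (μ n).real {x | η ≤ |x i - if dt i then 1 else 0|}) atTop (𝓝 0) := by
    intro i η hη
    have h := tendstoInMeasure_iff_dist.1 (tendstoInMeasure_of_tendsto_ae
      (fun n => (hvi n i).aestronglyMeasurable) (hT.ae_tendsto_v hdt hj (hfin j hj) i)) η hη
    refine ((ENNReal.tendsto_toReal ENNReal.zero_ne_top).comp h).congr fun n => ?_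
    exact congrArg ENNReal.toReal (hmap n i {y | η ≤ |y - if dt i then 1 else 0|}
      (measurableSet_le measurable_const (measurable_id.sub_const _).abs)).symm
  have hatom' : ∀ i, dt i = false →
      Tendsto (fun n => ⨆ s : ℝ, μ n {x | x i = s}) atTop (𝓝 0) := fun i hi =>
    (hatom i hi).congr fun n => iSup_congr fun s => (hmap n i {s} (measurableSet_singleton s)).symm
  obtain ⟨β, h1, h2, h3⟩ := exists_seq_tendsto_zero_of_eventually_exists
    (F := T.pBFDR) (α := α) (by
      intro ε hε
      have hε' : 0 < min (ε / 2) (1 / 2) := lt_min (half_pos hε) (by norm_num)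
      filter_upwards [eventually_exists_threshold h01 hconv hatom' hm hα hα' hε'] with
        n ⟨b, hb0, hb1, hbε, hN, hD⟩
      have hle1 := min_le_left (ε / 2) (1 / 2)
      have hle2 := min_le_right (ε / 2) (1 / 2)
      refine ⟨b, hb0, hb1, by linarith, ?_⟩
      rw [hT.pBFDR_eq_div]
      set D := (μ n).real {x | ∃ i, b < x i}
      set N := ∫ x, thresholdFDR b x ∂μ n
      have hND : N ≤ D := integral_thresholdFDR_le (h01 n) b
      have hN0 : 0 ≤ N := integral_nonneg_of_ae (by
        filter_upwards [h01 n] with x hx using thresholdFDR_nonneg hx)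
      have hD1 : D ≤ 1 := measureReal_le_one
      have hDpos : 0 < D := by linarith
      -- `N ≤ N / D ≤ N + (1 - D)`, because `0 ≤ N ≤ D ≤ 1`
      have hl : N ≤ N / D := le_div_self hN0 hDpos hD1
      have hu : N / D ≤ N + (1 - D) := by
        rw [div_le_iff₀ hDpos]
        nlinarith
      obtain ⟨hN1, hN2⟩ := abs_lt.1 hN
      exact abs_lt.2 ⟨by linarith, by linarith⟩)
  refine ⟨β, h1, h2, ?_, h3⟩
  -- conditioning on a null event would make the rate vanish
  filter_upwards [h3.eventually_const_lt hα] with n hn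
  refine pos_iff_ne_zero.2 fun h0 => hn.ne' ?_
  rw [TestingProblem.pBFDR, ProbabilityTheory.cond_eq_zero_of_meas_eq_zero h0, integral_zero_measure]
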